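/- Let $\mathbb{A}$ be the ring of adeles of $\mathbb{Q}$, let $\mathrm{GL}_2(\mathbb{A})=\mathrm{GL}_2(\mathbb{R})\times\prod'_p\mathrm{GL}_2(\mathbb{Q}_p)$ (restricted product with respect to $\mathrm{GL}_2(\mathbb{Z}_p)$), let $G_{\mathbb{A}}=\{g\in\mathrm{GL}_2(\mathbb{A}) : \prod_\nu|\det g^{(\nu)}|_\nu=1\}$, let $\Gamma_{\mathbb{A}}=\mathrm{GL}_2(\mathbb{Q})$ be embedded diagonally, and let $X_{\mathbb{A}}=\Gamma_{\mathbb{A}}\backslash G_{\mathbb{A}}$, with origin $x_{\mathbb{A}}=\Gamma_{\mathbb{A}}\cdot\mathrm{Id}$ and $G_{\mathbb{A}}$-invariant Borel probability measure $\mu_{\mathrm{Haar},\mathbb{A}}$. For $g\in G_{\mathbb{A}}$ and a measure $\mu$ on $X_{\mathbb{A}}$, let $g^{-1}\mu$ be the push-forward of $\mu$ under $x\mapsto xg$. Let $A_{\mathbb{A}}\le G_{\mathbb{A}}$ be the diagonal subgroup, let $a(t)=\mathrm{diag}(e^{-t/2},e^{t/2})$, and let $A_{\mathbb{A}}^+=\{(a(t),a^{(f)})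 : t\in\mathbb{R},\ a^{(f)}\in\prod_p\{\mathrm{diag}(\alpha,\beta) : \alpha,\beta\in\mathbb{Z}_p^\times\}\}$, with the Haar measure that is the product of Lebesgue measure $dt$ and the Haar probability measure in $a^{(f)}$. Let $\delta_{x_{\mathbb{A}}A_{\mathbb{A}}}$ be the $A_{\mathbb{A}}$-invariant locally finite orbit measure on $x_{\mathbb{A}}A_{\mathbb{A}}=x_{\mathbb{A}}A_{\mathbb{A}}^+$, normalized to be the push-forward of this Haar measure under $a\mapsto x_{\mathbb{A}}a$. For an interval $I\subseteq\mathbb{R}$ let $\delta_{x_{\mathbb{A}}A_{\mathbb{A}}^I}$ be its restriction to $\{x_{\mathbb{A}}(a(t),a^{(f)}) : (a(t),a^{(f)})\in A_{\mathbb{A}}^+,\ t\in I\}$. Let $(n_i)$ and $(m_i)$ be sequences of natural numbers with $n_i\ge 0$ and $m_i\geq 1$ such that $m_i\to\infty$ or $n_i\to\infty$, and such that $n_i=0$ for all $i$ if $n_i\not\to\infty$. With $u_x=\begin{pmatrix}1&x\\0&1\end{pmatrix}$, let $g_i=(u_{n_i},u_{1/m_i}^{(f)})\in G_{\mathbb{A}}$,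 that is, the element with real component $u_{n_i}$ and with component $u_{1/m_i}$ at every prime, and let $T_i=\ln(\max\{1,n_i\}\cdot m_i)$. Suppose that the measures $\frac1{T_i}\,g_i^{-1}\delta_{x_{\mathbb{A}}A_{\mathbb{A}}^{[0,T_i]}}$ equidistribute, i.e. that $$\frac1{T_i}\,\bigl(g_i^{-1}\delta_{x_{\mathbb{A}}A_{\mathbb{A}}^{[0,T_i]}}\bigr)(f)\to\mu_{\mathrm{Haar},\mathbb{A}}(f)\qquad\text{for every } f\in C_c(X_{\mathbb{A}}).$$ Then the homothety classes $g_i^{-1}[\delta_{x_{\mathbb{A}}A_{\mathbb{A}}}]$ equidistribute: the measures $g_i^{-1}\delta_{x_{\mathbb{A}}A_{\mathbb{A}}}$ are nonzero and finite on compact sets, and there are scalars $d_i>0$ such that $d_i\,\bigl(g_i^{-1}\delta_{x_{\mathbb{A}}A_{\mathbb{A}}}\bigr)(f)\to\mu_{\mathrm{Haar},\mathbb{A}}(f)$ for every $f\in C_c(X_{\mathbb{A}})$. -/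

import Mathlib

open MeasureTheory Filter Topology
open scoped RestrictedProduct

noncomputable section

namespace AdelicShearing

/-- The set `ℙ` of the prime numbers. -/
abbrev Primes : Type := {p : ℕ // p.Prime}

instance (p : Primes) : Fact (p : ℕ).Prime := ⟨p.2⟩

/-! ### Matrices over a ring -/

/-- The unipotent matrix `u_x = (1 x; 0 1)`. -/
def u {R : Type*} [CommRing R] (x : R) : GL (Fin 2) R :=
  Matrix.GeneralLinearGroup.upperRightHom x

/-- The diagonal matrices `diag(α, β)` of `GL₂(R)`. -/
def diagHom (R : Type*) [CommRing R] : Rˣ × Rˣ →* GL (Fin 2) R where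
  toFun c :=
    { val := !![(c.1 : R), 0; 0, (c.2 : R)]
      inv := !![((c.1⁻¹ : Rˣ) : R), 0; 0, ((c.2⁻¹ : Rˣ) : R)]
      val_inv := by simp [Matrix.one_fin_two]
      inv_val := by simp [Matrix.one_fin_two] }
  map_one' := by ext i j; fin_cases i <;> fin_cases j <;> simp
  map_mul' c d := by ext i j; fin_cases i <;> fin_cases j <;> simp

/-- The real diagonal matrix `a(t) = diag(e^{-t/2}, e^{t/2})`. -/
def a (t : ℝ) : GL (Fin 2) ℝ :=
  diagHom ℝ (Units.mk0 (Real.exp (-t / 2)) (Real.exp_ne_zero _),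
    Units.mk0 (Real.exp (t / 2)) (Real.exp_ne_zero _))

lemma det_u {R : Type*} [CommRing R] (x : R) : (u x).val.det = 1 := by
  simp [u, Matrix.det_fin_two]

lemma det_diagHom {R : Type*} [CommRing R] (c : Rˣ × Rˣ) :
    (diagHom R c).val.det = (c.1 : R) * c.2 := by
  simp [diagHom, Matrix.det_fin_two]

lemma det_a (t : ℝ) : (a t).val.det = 1 := by
  rw [a, det_diagHom]
  simp only [Units.val_mk0]
  rw [← Real.exp_add]
  simp [neg_div]

/-! ### The group `GL₂(𝔸)` -/

/-- The subgroup `GL₂(ℤ_p)` of `GL₂(ℚ_p)`. -/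
def intGL (p : Primes) : Subgroup (GL (Fin 2) ℚ_[p]) :=
  (Matrix.GeneralLinearGroup.map (n := Fin 2) (PadicInt.Coe.ringHom (p := p))).range

/-- The finite part of `GL₂(𝔸)`: the restricted product of the groups `GL₂(ℚ_p)` with respect
to the subgroups `GL₂(ℤ_p)`. -/
abbrev FinGL : Type := Πʳ p : Primes, [GL (Fin 2) ℚ_[p], intGL p]

/-- `GL₂(𝔸) = GL₂(ℝ) × ∏'_p GL₂(ℚ_p)`. -/
abbrev AdelicGL : Type := GL (Fin 2) ℝ × FinGL

lemma mem_intGL {p : Primes} {g : GL (Fin 2) ℚ_[p]}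
    (h : ∀ i j, ‖g.val i j‖ ≤ 1) (h' : ∀ i j, ‖(g⁻¹).val i j‖ ≤ 1) : g ∈ intGL p := by
  let M : Matrix (Fin 2) (Fin 2) ℤ_[p] := fun i j => ⟨g.val i j, h i j⟩
  let N : Matrix (Fin 2) (Fin 2) ℤ_[p] := fun i j => ⟨(g⁻¹).val i j, h' i j⟩
  have inj : Function.Injective
      (fun A : Matrix (Fin 2) (Fin 2) ℤ_[p] => (PadicInt.Coe.ringHom (p := p)).mapMatrix A) := by
    intro A B hAB
    ext i j
    have hij : (A i j : ℚ_[p]) = (B i j : ℚ_[p]) := congrFun (congrFun hAB i) j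
    exact Subtype.ext hij
  have hM : (PadicInt.Coe.ringHom (p := p)).mapMatrix M = g.val := rfl
  have hN : (PadicInt.Coe.ringHom (p := p)).mapMatrix N = (g⁻¹).val := rfl
  refine ⟨⟨M, N, ?_, ?_⟩, ?_⟩
  · apply inj
    simp only [map_mul, hM, hN, map_one, Units.mul_inv]
  · apply inj
    simp only [map_mul, hM, hN, map_one, Units.inv_mul]
  · exact Units.ext hM

lemma norm_det_of_mem_intGL {p : Primes} {g : GL (Fin 2) ℚ_[p]} (h : g ∈ intGL p) :
    ‖g.val.det‖ = 1 := by
  obtain ⟨k, rfl⟩ := h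
  have h1 : (Matrix.GeneralLinearGroup.map (n := Fin 2) (PadicInt.Coe.ringHom (p := p)) k).val.det
      = ((k.val.det : ℤ_[p]) : ℚ_[p]) :=
    (RingHom.map_det (PadicInt.Coe.ringHom (p := p)) k.val).symm
  rw [h1]
  exact PadicInt.isUnit_iff.1 ((Matrix.isUnit_iff_isUnit_det _).1 k.isUnit)

lemma finite_norm_det (g : FinGL) :
    Function.HasFiniteMulSupport (fun p : Primes => ‖(g p).val.det‖) := by
  refine Set.Finite.subset (Filter.eventually_cofinite.1 g.2) ?_
  intro p hp hmem
  exact hp (norm_det_of_mem_intGL hmem)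

/-- `|det| : GL₂(𝔸) → ℝ`, the product over all places of the absolute values of the determinants.
The factors at the primes are `1` up to finitely many. -/
def absDet : AdelicGL →* ℝ where
  toFun g := |g.1.val.det| * ∏ᶠ p : Primes, ‖(g.2 p).val.det‖
  map_one' := by simp
  map_mul' g h := by
    have : ∀ p : Primes, ‖((g * h).2 p).val.det‖ = ‖(g.2 p).val.det‖ * ‖(h.2 p).val.det‖ := by
      intro p
      rw [← norm_mul, ← Matrix.det_mul]
      rfl
    simp only [this]
    rw [finprod_mul_distrib (finite_norm_det g.2) (finite_norm_det h.2)]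
    simp only [Prod.fst_mul, Units.val_mul, Matrix.det_mul, abs_mul]
    ring

/-- `G_𝔸 = GL₂¹(𝔸)`. -/
def GA : Subgroup AdelicGL := absDet.ker

/-! ### The diagonal embedding of `GL₂(ℚ)` and the space `X_𝔸` -/

lemma finite_not_integral (x : ℚ) : {p : Primes | ¬ ‖(x : ℚ_[p])‖ ≤ 1}.Finite := by
  refine Set.Finite.subset
    (Set.Finite.preimage Subtype.val_injective.injOn x.den.primeFactors.finite_toSet) ?_
  intro p hp
  have : (p : ℕ) ∣ x.den := by
    by_contra h
    exact hp (Padic.norm_rat_le_one h)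
  simpa using ⟨p.2, this⟩

/-- `q ↦ q^{(f)} = (q, q, q, …)`, the diagonal embedding of `GL₂(ℚ)` in the finite part. -/
def ratFin : GL (Fin 2) ℚ →* FinGL where
  toFun q := ⟨fun p => Matrix.GeneralLinearGroup.map (algebraMap ℚ ℚ_[p]) q, by
    have h1 : ∀ i j, ∀ᶠ p : Primes in cofinite, ‖((q.val i j : ℚ) : ℚ_[p])‖ ≤ 1 :=
      fun i j => finite_not_integral _
    have h2 : ∀ i j, ∀ᶠ p : Primes in cofinite, ‖(((q⁻¹).val i j : ℚ) : ℚ_[p])‖ ≤ 1 :=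
      fun i j => finite_not_integral _
    simp only [← Filter.eventually_all] at h1 h2
    filter_upwards [h1, h2] with p hp hp'
    refine mem_intGL (fun i j => ?_) (fun i j => ?_)
    · simpa using hp i j
    · rw [← map_inv]
      exact hp' i j⟩
  map_one' := RestrictedProduct.ext _ _ fun p =>
    map_one (Matrix.GeneralLinearGroup.map (n := Fin 2) (algebraMap ℚ ℚ_[p]))
  map_mul' q r := RestrictedProduct.ext _ _ fun p =>
    map_mul (Matrix.GeneralLinearGroup.map (n := Fin 2) (algebraMap ℚ ℚ_[p])) q r

/-- The diagonal embedding of `GL₂(ℚ)` in `GL₂(𝔸)`. -/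
def ratDiag : GL (Fin 2) ℚ →* AdelicGL :=
  (Matrix.GeneralLinearGroup.map (algebraMap ℚ ℝ)).prod ratFin

/-- `Γ_𝔸 = GL₂(ℚ)`, embedded diagonally, as a subgroup of `G_𝔸`. -/
def ΓA : Subgroup GA := ratDiag.range.subgroupOf GA

/-- `X_𝔸 = Γ_𝔸 \ G_𝔸`, the space of the cosets `Γ_𝔸 g`, with the quotient topology. -/
def XA : Type := Quotient (QuotientGroup.rightRel ΓA)

instance : TopologicalSpace XA :=
  inferInstanceAs (TopologicalSpace (Quotient (QuotientGroup.rightRel ΓA)))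

instance : MeasurableSpace XA := borel XA

instance : BorelSpace XA := ⟨rfl⟩

/-- The coset `Γ_𝔸 g`. -/
def XA.mk (g : GA) : XA := Quotient.mk (QuotientGroup.rightRel ΓA) g

/-- The origin `x_𝔸 = Γ_𝔸 · Id` of `X_𝔸`. -/
def XA.origin : XA := XA.mk 1

/-- The right action of `G_𝔸` on `X_𝔸`: `(Γ_𝔸 h) g = Γ_𝔸 (h g)`. -/
def XA.mulRight (x : XA) (g : GA) : XA :=
  Quotient.map (fun h : GA => h * g) (by
    intro h h' hh
    have hh' : h' * h⁻¹ ∈ ΓA := QuotientGroup.rightRel_apply.1 hh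
    refine QuotientGroup.rightRel_apply.2 ?_
    simpa [mul_assoc] using hh') x

/-- The translate `g μ` of a measure on `X_𝔸`, for the left action `g · x = x g⁻¹`: if `μ` is
carried by `Y`, then `g μ` is carried by `Y g⁻¹`. -/
def translate (g : GA) (μ : Measure XA) : Measure XA :=
  μ.map (fun x => x.mulRight g⁻¹)

/-- `μ` is the `G_𝔸`-invariant Borel probability measure `μ_{Haar,𝔸}` of `X_𝔸`. -/
structure IsHaarProbability (μ : Measure XA) : Prop where
  isProbabilityMeasure : IsProbabilityMeasure μ
  translate_eq : ∀ g : GA, translate g μ = μ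

/-! ### The diagonal group and its orbit measure -/

/-- `A_𝔸`, the subgroup of the elements of `G_𝔸` that are diagonal at every place. -/
def AA : Subgroup GA where
  carrier := {g | g.1.1 ∈ (diagHom ℝ).range ∧ ∀ p : Primes, g.1.2 p ∈ (diagHom ℚ_[p]).range}
  mul_mem' := fun hg hh => ⟨mul_mem hg.1 hh.1, fun p => mul_mem (hg.2 p) (hh.2 p)⟩
  one_mem' := ⟨one_mem _, fun _ => one_mem _⟩
  inv_mem' := fun hg => ⟨inv_mem hg.1, fun p => inv_mem (hg.2 p)⟩

/-- The compact group `∏_p A_p⁺ ≅ ∏_p (ℤ_pˣ)²`. -/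
abbrev CompactDiag : Type := (p : Primes) → ℤ_[p]ˣ × ℤ_[p]ˣ

instance : MeasurableSpace CompactDiag := borel CompactDiag

instance : BorelSpace CompactDiag := ⟨rfl⟩

lemma map_diagHom_mem (p : Primes) (c : ℤ_[p]ˣ × ℤ_[p]ˣ) :
    Matrix.GeneralLinearGroup.map (PadicInt.Coe.ringHom (p := p)) (diagHom ℤ_[p] c) ∈ intGL p :=
  ⟨_, rfl⟩

/-- The element `(diag(α_p, β_p))_p` of the finite part of `GL₂(𝔸)`. -/
def compactDiagToFin (c : CompactDiag) : FinGL :=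
  RestrictedProduct.structureMap _ _ _ fun p => ⟨_, map_diagHom_mem p (c p)⟩

/-- The parametrization of `A_𝔸⁺ = A × ∏_p A_p⁺` by `ℝ × ∏_p (ℤ_pˣ)²`, which sends `(t, c)` to
`(a(t), c)`. -/
def aPlus (s : ℝ × CompactDiag) : GA :=
  ⟨(a s.1, compactDiagToFin s.2), by
    have h : ∀ p : Primes, ‖((compactDiagToFin s.2) p).val.det‖ = 1 := fun p =>
      norm_det_of_mem_intGL (map_diagHom_mem p (s.2 p))
    simp [GA, MonoidHom.mem_ker, absDet, det_a, h]⟩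

lemma map_diagHom {R S : Type*} [CommRing R] [CommRing S] (f : R →+* S) (c : Rˣ × Rˣ) :
    Matrix.GeneralLinearGroup.map f (diagHom R c) =
      diagHom S (Units.map f.toMonoidHom c.1, Units.map f.toMonoidHom c.2) := by
  ext i j
  fin_cases i <;> fin_cases j <;> simp [diagHom]

lemma aPlus_mem (s : ℝ × CompactDiag) : aPlus s ∈ AA :=
  ⟨MonoidHom.mem_range.2 ⟨_, rfl⟩, fun p => MonoidHom.mem_range.2 ⟨_, (map_diagHom _ (s.2 p)).symm⟩⟩

/-- The Haar measure of `A_𝔸⁺`: Lebesgue measure in the real time `t` times the Haar probability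
measure of `∏_p A_p⁺`. -/
def haarPlus : Measure (ℝ × CompactDiag) :=
  (volume : Measure ℝ).prod (Measure.haarMeasure ⊤)

/-- The orbit measure `δ_{x_𝔸 A_𝔸}`, the push-forward of the Haar measure of `A_𝔸⁺` under
`a ↦ x_𝔸 a`. The group `A_𝔸⁺` is open in `A_𝔸` and meets every coset of the stabilizer of `x_𝔸` in
`A_𝔸` exactly once; `A_𝔸`-invariance is proved in `translate_orbitMeasure`. -/
def orbitMeasure : Measure XA :=
  haarPlus.map fun s => XA.origin.mulRight (aPlus s)

/-- The part `x_𝔸 A_𝔸^I` of the orbit with real times in `I`. -/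
def orbitSegment (I : Set ℝ) : Set XA :=
  {x | ∃ s : ℝ × CompactDiag, s.1 ∈ I ∧ x = XA.origin.mulRight (aPlus s)}

/-- `δ_{x_𝔸 A_𝔸^I}`, the restriction of the orbit measure to `x_𝔸 A_𝔸^I`. -/
def orbitMeasureOn (I : Set ℝ) : Measure XA :=
  orbitMeasure.restrict (orbitSegment I)

/-- The element `(u_n, u_{1/m}^{(f)})` of `G_𝔸`. -/
def shear (n m : ℕ) : GA :=
  ⟨(u (n : ℝ), ratFin (u (1 / (m : ℚ)))), by
    have h : ∀ p : Primes, ‖((ratFin (u (1 / (m : ℚ)))) p).val.det‖ = 1 := fun p => by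
      have h1 : ((ratFin (u (1 / (m : ℚ)))) p).val.det
          = algebraMap ℚ ℚ_[p] (u (1 / (m : ℚ))).val.det :=
        (RingHom.map_det (algebraMap ℚ ℚ_[p]) _).symm
      rw [h1, det_u, map_one, norm_one]
    rw [GA, MonoidHom.mem_ker]
    change |(u (n : ℝ)).val.det| * ∏ᶠ p : Primes, _ = 1
    simp only [h, finprod_one, det_u, abs_one, mul_one]⟩

/-- The time `T = ln(max{1, n} · m)`. -/
def shearTime (n m : ℕ) : ℝ := Real.log ((max 1 n * m : ℕ) : ℝ)

/-! ### Convergence of measures -/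

/-- Weak-* convergence `μ_i → ν`: `μ_i(f) → ν(f)` for every `f ∈ C_c(Z)`. -/
def WeakStarTendsto {Z : Type*} [TopologicalSpace Z] [MeasurableSpace Z]
    (μ : ℕ → Measure Z) (ν : Measure Z) : Prop :=
  ∀ f : Z → ℝ, Continuous f → HasCompactSupport f →
    Tendsto (fun i => ∫ z, f z ∂(μ i)) atTop (𝓝 (∫ z, f z ∂ν))

/-- `μ` is a nonzero locally finite measure: it is finite on compact sets. -/
def IsNonzeroLocallyFinite {Z : Type*} [TopologicalSpace Z] [MeasurableSpace Z]
    (μ : Measure Z) : Prop :=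
  μ ≠ 0 ∧ ∀ K : Set Z, IsCompact K → μ K < ⊤

/-- Convergence `[μ_i] → [ν]` of homothety classes of nonzero locally finite measures:
`d_i μ_i → ν` in the weak-* sense for some scalars `d_i > 0`. -/
def ClassTendsto {Z : Type*} [TopologicalSpace Z] [MeasurableSpace Z]
    (μ : ℕ → Measure Z) (ν : Measure Z) : Prop :=
  (∀ i, IsNonzeroLocallyFinite (μ i)) ∧ IsNonzeroLocallyFinite ν ∧
    ∃ d : ℕ → ℝ, (∀ i, 0 < d i) ∧ WeakStarTendsto (fun i => ENNReal.ofReal (d i) • μ i) ν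

/-! ### Invariance of the orbit measure -/

lemma continuous_diagHom (R : Type*) [CommRing R] [TopologicalSpace R] :
    Continuous (diagHom R) := by
  have h : Continuous fun c => (diagHom R c).val := by
    refine continuous_matrix fun i j => ?_
    fin_cases i <;> fin_cases j <;> simp [diagHom] <;> fun_prop
  refine Units.continuous_iff.2 ⟨h, ?_⟩
  simp only [← map_inv]
  refine h.comp (Continuous.prodMk ?_ ?_)
  · exact Units.continuous_iff.2 ⟨Units.continuous_coe_inv.comp continuous_fst,
      Units.continuous_val.comp continuous_fst⟩
  · exact Units.continuous_iff.2 ⟨Units.continuous_coe_inv.comp continuous_snd,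
      Units.continuous_val.comp continuous_snd⟩

lemma continuous_glMap {R S : Type*} [CommRing R] [CommRing S] [TopologicalSpace R]
    [TopologicalSpace S] (f : R →+* S) (hf : Continuous f) :
    Continuous (Matrix.GeneralLinearGroup.map (n := Fin 2) f) := by
  have h : Continuous fun g : GL (Fin 2) R =>
      (Matrix.GeneralLinearGroup.map (n := Fin 2) f g).val := by
    refine continuous_matrix fun i j => ?_
    exact hf.comp (Units.continuous_val.matrix_elem i j)
  refine Units.continuous_iff.2 ⟨h, ?_⟩
  simp only [← map_inv]
  exact h.comp (Units.continuous_iff.2 ⟨Units.continuous_coe_inv, Units.continuous_val⟩)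

lemma continuous_a : Continuous a := by
  refine (continuous_diagHom ℝ).comp (Continuous.prodMk ?_ ?_)
  · refine Units.continuous_iff.2 ⟨by simp only [Function.comp_def, Units.val_mk0]; fun_prop, ?_⟩
    simp only [Units.val_inv_eq_inv_val, Units.val_mk0, ← Real.exp_neg]
    fun_prop
  · refine Units.continuous_iff.2 ⟨by simp only [Function.comp_def, Units.val_mk0]; fun_prop, ?_⟩
    simp only [Units.val_inv_eq_inv_val, Units.val_mk0, ← Real.exp_neg]
    fun_prop

lemma continuous_aPlus : Continuous aPlus := by
  refine Continuous.subtype_mk (Continuous.prodMk (continuous_a.comp continuous_fst) ?_) _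
  refine Continuous.comp RestrictedProduct.isEmbedding_structureMap.continuous ?_
  refine continuous_pi fun p => Continuous.subtype_mk ?_ _
  refine (continuous_glMap _ ?_).comp ((continuous_diagHom ℤ_[p]).comp
    ((continuous_apply p).comp continuous_snd))
  exact continuous_subtype_val

lemma continuous_orbitMap : Continuous fun s => XA.origin.mulRight (aPlus s) := by
  have : (fun s => XA.origin.mulRight (aPlus s)) = fun s => XA.mk (aPlus s) := by
    ext s
    change XA.mk (1 * aPlus s) = _
    rw [one_mul]
  rw [this]
  exact continuous_quot_mk.comp continuous_aPlus

lemma norm_le_of_mem {p : Primes} {g : GL (Fin 2) ℚ_[p]} (h : g ∈ intGL p) (i j : Fin 2) :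
    ‖g.val i j‖ ≤ 1 := by
  obtain ⟨k, rfl⟩ := h
  exact (k.val i j).2

lemma isOpen_intGL (p : Primes) : IsOpen (intGL p : Set (GL (Fin 2) ℚ_[p])) := by
  have : (intGL p : Set (GL (Fin 2) ℚ_[p])) =
      ⋂ i, ⋂ j, ({g | g.val i j ∈ Metric.closedBall 0 1} ∩
        {g | (g⁻¹).val i j ∈ Metric.closedBall 0 1}) := by
    ext g
    simp only [Set.mem_iInter, Set.mem_inter_iff, Set.mem_ofPred_eq, mem_closedBall_zero_iff]
    exact ⟨fun h i j => ⟨norm_le_of_mem h i j, norm_le_of_mem (inv_mem h) i j⟩,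
      fun h => mem_intGL (fun i j => (h i j).1) (fun i j => (h i j).2)⟩
  rw [this]
  refine isOpen_iInter_of_finite fun i => isOpen_iInter_of_finite fun j => IsOpen.inter ?_ ?_
  · exact (IsUltrametricDist.isOpen_closedBall 0 one_ne_zero).preimage
      (Units.continuous_val.matrix_elem i j)
  · exact (IsUltrametricDist.isOpen_closedBall 0 one_ne_zero).preimage
      (Units.continuous_coe_inv.matrix_elem i j)

instance : Fact (∀ p : Primes, IsOpen (intGL p : Set (GL (Fin 2) ℚ_[p]))) := ⟨isOpen_intGL⟩

lemma continuous_mulRight (g : GA) : Continuous fun x : XA => x.mulRight g := by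
  refine continuous_quot_lift _ ?_
  exact continuous_quot_mk.comp (continuous_mul_const g)

lemma aPlus_mul (s s' : ℝ × CompactDiag) :
    aPlus s * aPlus s' = aPlus (s.1 + s'.1, s.2 * s'.2) := by
  refine Subtype.ext (Prod.ext ?_ (RestrictedProduct.ext _ _ fun p => ?_))
  · change a s.1 * a s'.1 = a (s.1 + s'.1)
    rw [a, a, a, ← map_mul]
    congr 1
    ext
    · simp [← Real.exp_add]; ring
    · simp [← Real.exp_add]; ring
  · exact (map_mul ((Matrix.GeneralLinearGroup.map (PadicInt.Coe.ringHom (p := p))).comp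
      (diagHom ℤ_[p])) (s.2 p) (s'.2 p)).symm

lemma map_haarPlus (s' : ℝ × CompactDiag) :
    haarPlus.map (fun s => (s.1 + s'.1, s.2 * s'.2)) = haarPlus :=
  ((measurePreserving_add_right (volume : Measure ℝ) s'.1).prod
    (measurePreserving_mul_right (Measure.haarMeasure (⊤ : TopologicalSpace.PositiveCompacts CompactDiag)) s'.2)).map_eq

lemma norm_prime_zpow (p q : Primes) (k : ℤ) :
    ‖(((q : ℕ) : ℚ_[p]) ^ k)‖ = if q = p then ((p : ℕ) : ℝ) ^ (-k) else 1 := by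
  rw [norm_zpow]
  split_ifs with h
  · subst h
    rw [Padic.norm_p, inv_zpow, zpow_neg]
  · have : ‖((q : ℕ) : ℚ_[p])‖ = 1 := by
      rw [Padic.norm_natCast_eq_one_iff]
      exact (Nat.coprime_primes p.2 q.2).2 fun h' => h (Subtype.ext h'.symm)
    rw [this, one_zpow]

lemma exists_rat (α : ∀ p : Primes, ℚ_[p]ˣ) (hα : ∀ᶠ p : Primes in cofinite, ‖(α p : ℚ_[p])‖ = 1) :
    ∃ r : ℚ, 0 < r ∧ (∀ p : Primes, ‖(r : ℚ_[p])‖ = ‖(α p : ℚ_[p])‖) ∧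
      (r : ℝ) * ∏ᶠ p : Primes, ‖(α p : ℚ_[p])‖ = 1 := by
  classical
  let S : Finset Primes := (Filter.eventually_cofinite.1 hα).toFinset
  have hS : ∀ p : Primes, p ∉ S → ‖(α p : ℚ_[p])‖ = 1 := by
    intro p hp
    by_contra h
    exact hp ((Filter.eventually_cofinite.1 hα).mem_toFinset.2 h)
  let k : Primes → ℤ := fun p => (α p : ℚ_[p]).valuation
  have hk : ∀ p : Primes, ‖(α p : ℚ_[p])‖ = ((p : ℕ) : ℝ) ^ (-k p) := fun p =>
    Padic.norm_eq_zpow_neg_valuation (α p).ne_zero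
  refine ⟨∏ q ∈ S, ((q : ℕ) : ℚ) ^ k q, ?_, ?_, ?_⟩
  · exact Finset.prod_pos fun q _ => zpow_pos (by exact_mod_cast q.2.pos) _
  · intro p
    push_cast
    rw [norm_prod]
    simp only [norm_prime_zpow]
    rw [Finset.prod_ite_eq']
    split_ifs with h
    · exact (hk p).symm
    · exact (hS p h).symm
  · rw [finprod_eq_prod_of_mulSupport_subset (s := S)]
    · push_cast
      rw [← Finset.prod_mul_distrib]
      refine Finset.prod_eq_one fun p _ => ?_
      have : ((p : ℕ) : ℝ) ≠ 0 := by exact_mod_cast p.2.ne_zero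
      rw [hk p, ← zpow_add₀ this]
      simp
    · intro p hp
      by_contra h
      exact hp (hS p h)

lemma exists_unit {p : Primes} (x : ℚ_[p]ˣ) (hx : ‖(x : ℚ_[p])‖ = 1) :
    ∃ y : ℤ_[p]ˣ, Units.map (PadicInt.Coe.ringHom (p := p)).toMonoidHom y = x := by
  let z : ℤ_[p] := ⟨x, hx.le⟩
  obtain ⟨y, hy⟩ := PadicInt.isUnit_iff.2 (show ‖z‖ = 1 from hx)
  exact ⟨y, Units.ext (congrArg Subtype.val hy)⟩

lemma exists_decomp (b : GA) (hb : b ∈ AA) :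
    ∃ γ ∈ ΓA, γ ∈ AA ∧ ∃ s, b = γ * aPlus s := by
  obtain ⟨⟨x, hx⟩, hb2⟩ := hb
  choose y hy using hb2
  have hdet : ∀ p : Primes, ‖((y p).1 : ℚ_[p])‖ * ‖((y p).2 : ℚ_[p])‖ = ‖(b.1.2 p).val.det‖ := by
    intro p
    rw [← hy p, det_diagHom, norm_mul]
  have hev : ∀ᶠ p : Primes in cofinite, ‖((y p).1 : ℚ_[p])‖ = 1 ∧ ‖((y p).2 : ℚ_[p])‖ = 1 := by
    filter_upwards [b.1.2.2] with p hp
    have h1 : ‖((y p).1 : ℚ_[p])‖ ≤ 1 := by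
      have := norm_le_of_mem hp 0 0
      change ‖(b.1.2 p).val 0 0‖ ≤ 1 at this
      rw [← hy p] at this
      simpa [diagHom] using this
    have h2 : ‖((y p).2 : ℚ_[p])‖ ≤ 1 := by
      have := norm_le_of_mem hp 1 1
      change ‖(b.1.2 p).val 1 1‖ ≤ 1 at this
      rw [← hy p] at this
      simpa [diagHom] using this
    have h3 := (hdet p).trans (norm_det_of_mem_intGL hp)
    have h4 := norm_nonneg ((y p).1 : ℚ_[p])
    have h5 := norm_nonneg ((y p).2 : ℚ_[p])
    constructor <;> nlinarith
  obtain ⟨r₁, hr₁, hn₁, hp₁⟩ := exists_rat (fun p => (y p).1) (hev.mono fun _ h => h.1)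
  obtain ⟨r₂, hr₂, hn₂, hp₂⟩ := exists_rat (fun p => (y p).2) (hev.mono fun _ h => h.2)
  have hsign : ∀ z : ℝˣ, ∃ e : ℚˣ, 0 < ((e : ℚ) : ℝ) * z ∧ |(e : ℚ)| = 1 := by
    intro z
    rcases lt_or_gt_of_ne z.ne_zero with h | h
    · exact ⟨-1, by simpa using h, by simp⟩
    · exact ⟨1, by simpa using h, by simp⟩
  obtain ⟨e₁, he₁, he₁'⟩ := hsign x.1
  obtain ⟨e₂, he₂, he₂'⟩ := hsign x.2
  have hnorm : ∀ (e : ℚˣ), |(e : ℚ)| = 1 → ∀ p : Primes, ‖((e : ℚ) : ℚ_[p])‖ = 1 := by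
    intro e he p
    rcases (abs_eq zero_le_one).1 he with h | h <;> simp [h]
  let q : ℚˣ × ℚˣ := (e₁ * Units.mk0 r₁ hr₁.ne', e₂ * Units.mk0 r₂ hr₂.ne')
  have hxy : |(x.1 : ℝ)| * |(x.2 : ℝ)| = r₁ * r₂ := by
    have h1 : |b.1.1.val.det| * ∏ᶠ p : Primes, ‖(b.1.2 p).val.det‖ = 1 := b.2
    simp only [← hdet] at h1
    rw [finprod_mul_distrib (Filter.eventually_cofinite.1 (hev.mono fun _ h => h.1))
      (Filter.eventually_cofinite.1 (hev.mono fun _ h => h.2)), ← hx, det_diagHom, abs_mul] at h1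
    have h2 : (r₁ : ℝ) ≠ 0 := by exact_mod_cast hr₁.ne'
    have h3 : (r₂ : ℝ) ≠ 0 := by exact_mod_cast hr₂.ne'
    rw [eq_div_of_mul_eq h2 ((mul_comm _ _).trans hp₁),
      eq_div_of_mul_eq h3 ((mul_comm _ _).trans hp₂)] at h1
    field_simp at h1
    exact h1
  have hq₁ : 0 < (x.1 : ℝ) / ((q.1 : ℚ) : ℝ) := by
    have h2 : (0 : ℝ) < r₁ := by exact_mod_cast hr₁
    rcases (abs_eq zero_le_one).1 he₁' with h | h <;> simp [q, h] at he₁ ⊢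
    · positivity
    · rw [div_neg, Left.neg_pos_iff]; exact div_neg_of_neg_of_pos he₁ h2
  have hq₂ : 0 < (x.2 : ℝ) / ((q.2 : ℚ) : ℝ) := by
    have h2 : (0 : ℝ) < r₂ := by exact_mod_cast hr₂
    rcases (abs_eq zero_le_one).1 he₂' with h | h <;> simp [q, h] at he₂ ⊢
    · positivity
    · rw [div_neg, Left.neg_pos_iff]; exact div_neg_of_neg_of_pos he₂ h2
  have hprod : ((x.1 : ℝ) / ((q.1 : ℚ) : ℝ)) * ((x.2 : ℝ) / ((q.2 : ℚ) : ℝ)) = 1 := by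
    rw [← abs_of_pos hq₁, ← abs_of_pos hq₂, abs_div, abs_div, div_mul_div_comm, hxy]
    have h1 : |((q.1 : ℚ) : ℝ)| = r₁ := by
      rw [← Rat.cast_abs]
      simp [q, abs_mul, he₁', abs_of_pos hr₁]
    have h2 : |((q.2 : ℚ) : ℝ)| = r₂ := by
      rw [← Rat.cast_abs]
      simp [q, abs_mul, he₂', abs_of_pos hr₂]
    rw [h1, h2]
    have h2 : (r₁ : ℝ) ≠ 0 := by exact_mod_cast hr₁.ne'
    have h3 : (r₂ : ℝ) ≠ 0 := by exact_mod_cast hr₂.ne'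
    field_simp
  have hc : ∀ p : Primes, ∃ c : ℤ_[p]ˣ × ℤ_[p]ˣ,
      Units.map (algebraMap ℚ ℚ_[p]).toMonoidHom q.1 *
        Units.map (PadicInt.Coe.ringHom (p := p)).toMonoidHom c.1 = (y p).1 ∧
      Units.map (algebraMap ℚ ℚ_[p]).toMonoidHom q.2 *
        Units.map (PadicInt.Coe.ringHom (p := p)).toMonoidHom c.2 = (y p).2 := by
    intro p
    obtain ⟨c₁, hc₁⟩ := exists_unit
      ((Units.map (algebraMap ℚ ℚ_[p]).toMonoidHom q.1)⁻¹ * (y p).1) (by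
        have := hnorm e₁ he₁' p
        have h0 : ‖((y p).1 : ℚ_[p])‖ ≠ 0 := by simp
        simp [q, this, hn₁ p, h0])
    obtain ⟨c₂, hc₂⟩ := exists_unit
      ((Units.map (algebraMap ℚ ℚ_[p]).toMonoidHom q.2)⁻¹ * (y p).2) (by
        have := hnorm e₂ he₂' p
        have h0 : ‖((y p).2 : ℚ_[p])‖ ≠ 0 := by simp
        simp [q, this, hn₂ p, h0])
    exact ⟨(c₁, c₂), by simp only [hc₁, mul_inv_cancel_left],
      by simp only [hc₂, mul_inv_cancel_left]⟩
  choose c hc₁ hc₂ using hc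
  let s : ℝ × CompactDiag := (-2 * Real.log ((x.1 : ℝ) / ((q.1 : ℚ) : ℝ)), c)
  have hb' : b.1 = ratDiag (diagHom ℚ q) * (aPlus s).1 := by
    refine Prod.ext ?_ (RestrictedProduct.ext _ _ fun p => ?_)
    · change b.1.1 = Matrix.GeneralLinearGroup.map (algebraMap ℚ ℝ) (diagHom ℚ q) * a s.1
      rw [map_diagHom, a, ← map_mul, ← hx]
      congr 1
      have hq1 : ((q.1 : ℚ) : ℝ) ≠ 0 := by exact_mod_cast q.1.ne_zero
      have hq2 : ((q.2 : ℚ) : ℝ) ≠ 0 := by exact_mod_cast q.2.ne_zero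
      refine Prod.ext (Units.ext ?_) (Units.ext ?_)
      · change (x.1 : ℝ) = ((q.1 : ℚ) : ℝ) * Real.exp (-(-2 * Real.log _) / 2)
        rw [show ∀ z : ℝ, -(-2 * z) / 2 = z from fun z => by ring, Real.exp_log hq₁]
        field_simp
      · change (x.2 : ℝ) = ((q.2 : ℚ) : ℝ) * Real.exp ((-2 * Real.log _) / 2)
        rw [show ∀ z : ℝ, (-2 * z) / 2 = -z from fun z => by ring, Real.exp_neg,
          Real.exp_log hq₁, ← eq_inv_of_mul_eq_one_right hprod]
        field_simp
    · change b.1.2 p = Matrix.GeneralLinearGroup.map (algebraMap ℚ ℚ_[p]) (diagHom ℚ q) *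
        Matrix.GeneralLinearGroup.map (PadicInt.Coe.ringHom (p := p)) (diagHom ℤ_[p] (c p))
      rw [map_diagHom, map_diagHom, ← map_mul, ← hy p]
      exact congrArg _ (Prod.ext (hc₁ p).symm (hc₂ p).symm)
  have hγ : ratDiag (diagHom ℚ q) ∈ GA := by
    rw [← mul_inv_eq_iff_eq_mul.2 hb']
    exact mul_mem b.2 (inv_mem (aPlus s).2)
  refine ⟨⟨_, hγ⟩, Subgroup.mem_subgroupOf.2 ⟨_, rfl⟩, ?_, s, Subtype.ext hb'⟩
  have : (⟨_, hγ⟩ : GA) = b * (aPlus s)⁻¹ := eq_mul_inv_of_mul_eq (Subtype.ext hb'.symm)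
  rw [this]
  exact mul_mem ⟨⟨x, hx⟩, fun p => ⟨y p, hy p⟩⟩ (inv_mem (aPlus_mem s))


lemma AA_comm (b c : GA) (hb : b ∈ AA) (hc : c ∈ AA) : b * c = c * b := by
  refine Subtype.ext (Prod.ext ?_ (RestrictedProduct.ext _ _ fun p => ?_))
  · obtain ⟨x, hx⟩ := hb.1
    obtain ⟨y, hy⟩ := hc.1
    change b.1.1 * c.1.1 = c.1.1 * b.1.1
    rw [← hx, ← hy, ← map_mul, ← map_mul, mul_comm]
  · obtain ⟨x, hx⟩ := hb.2 p
    obtain ⟨y, hy⟩ := hc.2 p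
    change b.1.2 p * c.1.2 p = c.1.2 p * b.1.2 p
    rw [← hx, ← hy, ← map_mul, ← map_mul, mul_comm]

/-- `δ_{x_𝔸 A_𝔸}` is `A_𝔸`-invariant: it is the invariant measure of the whole orbit `x_𝔸 A_𝔸`. -/
lemma translate_orbitMeasure (b : GA) (hb : b ∈ AA) :
    translate b orbitMeasure = orbitMeasure := by
  obtain ⟨γ, hγ, hγA, s', hs'⟩ := exists_decomp b⁻¹ (inv_mem hb)
  have key : ∀ s, (XA.origin.mulRight (aPlus s)).mulRight b⁻¹ =
      XA.origin.mulRight (aPlus (s.1 + s'.1, s.2 * s'.2)) := by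
    intro s
    rw [← aPlus_mul]
    change XA.mk (1 * aPlus s * b⁻¹) = XA.mk (1 * (aPlus s * aPlus s'))
    refine Quotient.sound (QuotientGroup.rightRel_apply.2 ?_)
    rw [hs', ← mul_assoc (1 * aPlus s), mul_assoc 1 (aPlus s) γ, AA_comm (aPlus s) γ (aPlus_mem s) hγA]
    convert inv_mem hγ using 1
    group
  rw [translate, orbitMeasure, Measure.map_map (continuous_mulRight _).measurable
    continuous_orbitMap.measurable]
  simp only [Function.comp_def, key]
  conv_rhs => rw [← map_haarPlus s']
  rw [Measure.map_map continuous_orbitMap.measurable (by fun_prop)]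
  rfl

end AdelicShearing

end

open AdelicShearing

/-!
Write `T = log (max 1 n * m)`. The proof compares the whole sheared orbit with its part at the
times `[0, T]` and takes `d = 1 / (2 T)`.

*The reflection.* The rational matrix `γ = (0 1/m; m 0)` satisfies
`γ (a(t) u_n, c u_{1/m}) h = (a(2T - t) u_n, c' u_{1/m})`, where `c'` is `c` with the two diagonal
entries exchanged at every prime, and where `h` has the components `(-1 0; m 1)` at the primes and
the real component `(-1 0; 1/n 1)`, or `(0 1; 1 0)` if `n = 0`
(`mk_aPlus_mul_shear_mul_reflection`). So the second half `[T, 2T]` of the orbit is a translate of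
the first half by `h⁻¹`. These `h` vary with `n` and `m`, but they stay in a compact subset of
`G_𝔸`. Since the limit measure is invariant and `f ∈ C_c(X_𝔸)` is uniformly continuous under right
translation, the translates of the first half have the same limit as the first half itself
(`tendsto_integral_mulRight`).

*The cusp.* If `γ g = (a(t) u_n, c u_{1/m})` with `g` in a compact set and `γ ∈ GL₂(ℚ)`, then the
bottom row of `γ` is a nonzero rational vector with bounded denominators and with real size
`O(e^{t/2})`, whence `t ≥ -C` (`exists_neg_le_time_of_isCompact`). By the reflection, also
`t ≤ 2T + C`. Hence the sheared orbit measures are locally finite, and the times outside `[0, 2T]`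
contribute `O(1)` to the integral of `f`, which is negligible since `T → ∞`
(`exists_abs_integral_sub_le`).

The restriction of the orbit measure to a compact time interval is the push-forward of the
restricted Haar measure because the orbit map is injective in the time variable
(`time_eq_of_mk_aPlus_eq`) and `X_𝔸` is Hausdorff, `Γ_𝔸` being discrete.
-/

namespace AdelicShearing

/-! ### Integrality of rational numbers -/

lemma exists_int_of_norm_le_one {x : ℚ} (hx : ∀ p : Primes, ‖(x : ℚ_[p])‖ ≤ 1) :
    ∃ k : ℤ, x = k := by
  refine ⟨x.num, (Rat.den_eq_one_iff x).1 ?_ |>.symm⟩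
  by_contra hden
  obtain ⟨p, hp, hpd⟩ := Nat.exists_prime_and_dvd hden
  have : Fact p.Prime := ⟨hp⟩
  have hnum : ‖((x.num : ℤ) : ℚ_[p])‖ = 1 := by
    rw [Padic.norm_intCast_eq_one_iff]
    exact (Int.isCoprime_iff_gcd_eq_one.2 (by
      have := x.reduced
      exact (Nat.Coprime.coprime_dvd_right hpd this)))
  have hden' : ‖((x.den : ℕ) : ℚ_[p])‖ < 1 := Padic.norm_natCast_lt_one_iff.2 hpd
  have hmul : (x : ℚ_[p]) * (x.den : ℚ_[p]) = (x.num : ℚ_[p]) := by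
    exact_mod_cast congrArg (Rat.cast : ℚ → ℚ_[p]) (Rat.mul_den_eq_num x)
  have h1 := hx ⟨p, hp⟩
  have h2 : ‖(x : ℚ_[p])‖ * ‖((x.den : ℕ) : ℚ_[p])‖ = 1 := by
    rw [← norm_mul, hmul, hnum]
  have h3 : ‖(x : ℚ_[p])‖ ≤ 1 := h1
  nlinarith [norm_nonneg ((x.den : ℕ) : ℚ_[p]), norm_nonneg (x : ℚ_[p])]

/-- A common denominator for a family of bounds that are at most `1` at almost every prime. -/
lemma exists_nat_norm_mul_le_one {c : Primes → ℝ} (hc : ∀ᶠ p in cofinite, c p ≤ 1) :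
    ∃ N : ℕ, 0 < N ∧ ∀ p : Primes, ‖(N : ℚ_[p])‖ * c p ≤ 1 := by
  classical
  let S : Finset Primes := (Filter.eventually_cofinite.1 hc).toFinset
  have hS : ∀ p : Primes, p ∉ S → c p ≤ 1 := by
    intro p hp
    by_contra h
    exact hp ((Filter.eventually_cofinite.1 hc).mem_toFinset.2 h)
  have hk : ∀ p : Primes, ∃ k : ℕ, ‖((p : ℕ) : ℚ_[p]) ^ k‖ * c p ≤ 1 := by
    intro p
    have ht : Tendsto (fun k : ℕ => ‖((p : ℕ) : ℚ_[p])‖ ^ k * c p) atTop (𝓝 (0 * c p)) :=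
      (tendsto_pow_atTop_nhds_zero_of_lt_one (norm_nonneg _) Padic.norm_p_lt_one).mul_const _
    rw [zero_mul] at ht
    obtain ⟨k, hk⟩ := (ht.eventually (ge_mem_nhds zero_lt_one)).exists
    exact ⟨k, by rwa [norm_pow]⟩
  choose k hk using hk
  refine ⟨∏ q ∈ S, (q : ℕ) ^ k q, Finset.prod_pos fun q _ => pow_pos q.2.pos _, fun p => ?_⟩
  by_cases hp : p ∈ S
  · rcases le_or_gt (c p) 0 with h | h
    · exact (mul_nonpos_of_nonneg_of_nonpos (norm_nonneg _) h).trans zero_le_one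
    · refine le_trans (mul_le_mul_of_nonneg_right ?_ h.le) (hk p)
      rw [← Finset.mul_prod_erase S _ hp]
      push_cast
      rw [norm_mul]
      refine mul_le_of_le_one_right (norm_nonneg _) ?_
      exact_mod_cast Padic.norm_int_le_one (p := p) ((∏ q ∈ S.erase p, (q : ℕ) ^ k q : ℕ) : ℤ)
  · have h1 : ‖((∏ q ∈ S, (q : ℕ) ^ k q : ℕ) : ℚ_[p])‖ ≤ 1 := by
      exact_mod_cast Padic.norm_int_le_one (p := p) ((∏ q ∈ S, (q : ℕ) ^ k q : ℕ) : ℤ)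
    rcases le_or_gt (c p) 0 with h | h
    · exact (mul_nonpos_of_nonneg_of_nonpos (norm_nonneg _) h).trans zero_le_one
    · exact mul_le_one₀ h1 h.le (hS p hp)

/-! ### The quotient `X_𝔸` -/

lemma mulRight_mk (g h : GA) : (XA.mk g).mulRight h = XA.mk (g * h) := rfl

lemma origin_mulRight (g : GA) : XA.origin.mulRight g = XA.mk g := by
  rw [XA.origin, mulRight_mk, one_mul]

lemma mulRight_mulRight (x : XA) (g h : GA) : (x.mulRight g).mulRight h = x.mulRight (g * h) := by
  induction x using Quotient.inductionOn with
  | h k => exact congrArg XA.mk (mul_assoc k g h)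

lemma mulRight_one (x : XA) : x.mulRight 1 = x := by
  induction x using Quotient.inductionOn with
  | h k => exact congrArg XA.mk (mul_one k)

lemma mk_eq_mk {g h : GA} : XA.mk g = XA.mk h ↔ h * g⁻¹ ∈ ΓA :=
  Quotient.eq.trans QuotientGroup.rightRel_apply

lemma mk_eq_mk_iff_exists {g h : GA} :
    XA.mk g = XA.mk h ↔ ∃ q : GL (Fin 2) ℚ, ratDiag q * g.1 = h.1 := by
  rw [mk_eq_mk, ΓA, Subgroup.mem_subgroupOf, MonoidHom.mem_range]
  refine exists_congr fun q => ?_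
  rw [Subgroup.coe_mul, Subgroup.coe_inv, eq_mul_inv_iff_mul_eq]

lemma continuous_mk : Continuous XA.mk := continuous_quot_mk

lemma isOpenQuotientMap_mk : IsOpenQuotientMap XA.mk where
  surjective := Quotient.mk_surjective
  continuous := continuous_mk
  isOpenMap := by
    intro V hV
    have : XA.mk ⁻¹' (XA.mk '' V) = ⋃ γ : ΓA, (fun g : GA => γ.1 * g) ⁻¹' V := by
      ext g
      simp only [Set.mem_preimage, Set.mem_image, Set.mem_iUnion]
      constructor
      · rintro ⟨h, hh, e⟩
        refine ⟨⟨h * g⁻¹, mk_eq_mk.1 e.symm⟩, ?_⟩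
        simpa using hh
      · rintro ⟨γ, hγ⟩
        exact ⟨_, hγ, (mk_eq_mk.2 (by simp)).symm⟩
    refine isOpen_coinduced.2 ?_
    change IsOpen (XA.mk ⁻¹' (XA.mk '' V))
    rw [this]
    exact isOpen_iUnion fun γ => hV.preimage (continuous_const_mul _)

lemma continuous_mulRight_uncurry : Continuous fun y : XA × GA => y.1.mulRight y.2 := by
  rw [← (isOpenQuotientMap_mk.prodMap IsOpenQuotientMap.id).continuous_comp_iff]
  exact continuous_mk.comp continuous_mul

/-- Right translation by `g`, as a homeomorphism of `X_𝔸`. -/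
noncomputable def mulRightHomeomorph (g : GA) : XA ≃ₜ XA where
  toFun x := x.mulRight g
  invFun x := x.mulRight g⁻¹
  left_inv x := (mulRight_mulRight x g g⁻¹).trans (by rw [mul_inv_cancel, mulRight_one])
  right_inv x := (mulRight_mulRight x g⁻¹ g).trans (by rw [inv_mul_cancel, mulRight_one])
  continuous_toFun := continuous_mulRight g
  continuous_invFun := continuous_mulRight g⁻¹

/-- The elements that are integral at every prime form an open set. -/
lemma isOpen_integral : IsOpen {g : GA | ∀ p : Primes, g.1.2 p ∈ intGL p} :=
  (RestrictedProduct.isOpen_forall_mem isOpen_intGL).preimage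
    (continuous_snd.comp continuous_subtype_val)

lemma continuous_realEntry (i j : Fin 2) : Continuous fun g : GA => g.1.1.val i j :=
  (Units.continuous_val.matrix_elem i j).comp (continuous_fst.comp continuous_subtype_val)

lemma ratFin_apply (q : GL (Fin 2) ℚ) (p : Primes) (i j : Fin 2) :
    ((ratFin q) p).val i j = ((q.val i j : ℚ) : ℚ_[p]) := rfl

lemma exists_int_of_ratFin_mem {q : GL (Fin 2) ℚ} (hq : ∀ p : Primes, (ratFin q) p ∈ intGL p)
    (i j : Fin 2) : ∃ k : ℤ, q.val i j = k :=
  exists_int_of_norm_le_one fun p => by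
    rw [← ratFin_apply]
    exact norm_le_of_mem (hq p) i j

/-- `Γ_𝔸` is discrete: an element that is integral at every prime and has real entries at
distance less than `1` from those of the identity is the identity. -/
instance : DiscreteTopology ΓA := by
  refine discreteTopology_of_isOpen_singleton_one ?_
  refine isOpen_induced_iff.2 ⟨{g : GA | (∀ p : Primes, g.1.2 p ∈ intGL p) ∧
    ∀ i j, |g.1.1.val i j - (1 : Matrix (Fin 2) (Fin 2) ℝ) i j| < 1}, ?_, ?_⟩
  · have hreal : IsOpen {g : GA |
        ∀ i j, |g.1.1.val i j - (1 : Matrix (Fin 2) (Fin 2) ℝ) i j| < 1} := by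
      simp only [Set.ofPred_forall]
      exact isOpen_iInter_of_finite fun i => isOpen_iInter_of_finite fun j =>
        isOpen_lt ((continuous_realEntry i j).sub continuous_const).abs continuous_const
    exact isOpen_integral.inter hreal
  · ext γ
    simp only [Set.mem_preimage, Set.mem_ofPred_eq, Set.mem_singleton_iff]
    constructor
    · rintro ⟨h1, h2⟩
      obtain ⟨q, hq⟩ := Subgroup.mem_subgroupOf.1 γ.2
      have hq1 : ∀ i j, ((γ.1 : GA).1.1).val i j = ((q.val i j : ℚ) : ℝ) := by
        intro i j; rw [← hq]; rfl
      have hq2 : ∀ p, (ratFin q) p = (γ.1 : GA).1.2 p := by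
        intro p; rw [← hq]; rfl
      have hone : q = 1 := by
        refine Units.ext (Matrix.ext fun i j => ?_)
        obtain ⟨k, hk⟩ := exists_int_of_ratFin_mem (fun p => (hq2 p).symm ▸ h1 p) i j
        have h3 := h2 i j
        rw [hq1, hk] at h3
        rw [hk, Units.val_one]
        have h4 : |k - (1 : Matrix (Fin 2) (Fin 2) ℤ) i j| < 1 := by
          have hcast : ((1 : Matrix (Fin 2) (Fin 2) ℤ) i j : ℝ) =
              (1 : Matrix (Fin 2) (Fin 2) ℝ) i j := by
            simp [Matrix.one_apply]
          rw [← hcast, Rat.cast_intCast] at h3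
          exact_mod_cast h3
        have h5 := Int.abs_lt_one_iff.1 h4
        have h6 : k = (1 : Matrix (Fin 2) (Fin 2) ℤ) i j := by omega
        rw [h6]
        simp [Matrix.one_apply]
      refine Subtype.ext (Subtype.ext ?_)
      rw [← hq, hone, map_one]; rfl
    · rintro rfl
      exact ⟨fun p => one_mem _, fun i j => by simp⟩

instance : T2Space XA := by
  refine (t2Space_iff_of_isOpenQuotientMap isOpenQuotientMap_mk).2 ?_
  have hΓ : IsClosed (ΓA : Set GA) := Subgroup.isClosed_of_discrete
  simp only [mk_eq_mk]
  exact hΓ.preimage (continuous_snd.mul continuous_fst.inv)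

/-! ### Coordinates of the sheared orbit -/

lemma u_val {R : Type*} [CommRing R] (x : R) : (u x).val = !![1, x; 0, 1] := by
  simp [u]

lemma a_val (t : ℝ) : (a t).val = !![Real.exp (-t / 2), 0; 0, Real.exp (t / 2)] := rfl

lemma aPlus_finite_val (s : ℝ × CompactDiag) (p : Primes) :
    ((aPlus s).1.2 p).val = !![((s.2 p).1 : ℚ_[p]), 0; 0, ((s.2 p).2 : ℚ_[p])] := by
  change (Matrix.GeneralLinearGroup.map (PadicInt.Coe.ringHom (p := p))
    (diagHom ℤ_[p] (s.2 p))).val = _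
  rw [map_diagHom]
  rfl

lemma aPlus_finite_mem (s : ℝ × CompactDiag) (p : Primes) : (aPlus s).1.2 p ∈ intGL p :=
  map_diagHom_mem p (s.2 p)

lemma orbit_real_val (s : ℝ × CompactDiag) (n m : ℕ) :
    (aPlus s * shear n m).1.1.val =
      !![Real.exp (-s.1 / 2), Real.exp (-s.1 / 2) * n; 0, Real.exp (s.1 / 2)] := by
  change (a s.1).val * (u (n : ℝ)).val = _
  rw [a_val, u_val]
  simp

lemma orbit_finite_val (s : ℝ × CompactDiag) (n m : ℕ) (p : Primes) :
    ((aPlus s * shear n m).1.2 p).val =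
      !![((s.2 p).1 : ℚ_[p]), ((s.2 p).1 : ℚ_[p]) / m; 0, ((s.2 p).2 : ℚ_[p])] := by
  have h : ((ratFin (u (1 / (m : ℚ)))) p).val = !![1, 1 / (m : ℚ_[p]); 0, 1] := by
    ext i j
    rw [ratFin_apply, u_val]
    fin_cases i <;> fin_cases j <;> simp
  change ((aPlus s).1.2 p).val * ((ratFin (u (1 / (m : ℚ)))) p).val = _
  rw [aPlus_finite_val, h]
  simp [div_eq_mul_inv]

lemma ratDiag_real_val (q : GL (Fin 2) ℚ) (i j : Fin 2) :
    (ratDiag q).1.val i j = ((q.val i j : ℚ) : ℝ) := rfl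

/-- The orbit map is injective in the real time: a rational matrix carrying one point of `A_𝔸⁺` to
another is diagonal, with integral entries that are positive and have product `1`. -/
lemma time_eq_of_mk_aPlus_eq {s s' : ℝ × CompactDiag} (h : XA.mk (aPlus s) = XA.mk (aPlus s')) :
    s.1 = s'.1 := by
  obtain ⟨q, hq⟩ := mk_eq_mk_iff_exists.1 h
  have hint := exists_int_of_ratFin_mem (q := q) fun p => by
    have hp : (ratFin q) p * (aPlus s).1.2 p = (aPlus s').1.2 p := by rw [← hq]; rfl
    rw [← eq_mul_inv_iff_mul_eq] at hp
    rw [hp]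
    exact mul_mem (aPlus_finite_mem s' p) (inv_mem (aPlus_finite_mem s p))
  have hreal : (ratDiag q).1.val * (a s.1).val = (a s'.1).val :=
    congrArg (fun g : AdelicGL => g.1.val) hq
  have h0 := congrFun (congrFun hreal 0) 0
  have h1 := congrFun (congrFun hreal 1) 1
  simp only [a_val, Matrix.mul_apply, Fin.sum_univ_two, ratDiag_real_val, Matrix.of_apply,
    Matrix.cons_val', Matrix.cons_val_zero, Matrix.cons_val_one, Matrix.cons_val_fin_one, mul_zero,
    add_zero, zero_add] at h0 h1
  obtain ⟨k, hk⟩ := hint 0 0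
  obtain ⟨l, hl⟩ := hint 1 1
  rw [hk, Rat.cast_intCast] at h0
  rw [hl, Rat.cast_intCast] at h1
  have hkpos : (0 : ℝ) < k := pos_of_mul_pos_left (h0 ▸ Real.exp_pos _) (Real.exp_pos _).le
  have hlpos : (0 : ℝ) < l := pos_of_mul_pos_left (h1 ▸ Real.exp_pos _) (Real.exp_pos _).le
  have hk1 : (1 : ℝ) ≤ k := by exact_mod_cast Int.add_one_le_iff.2 (by exact_mod_cast hkpos : 0 < k)
  have hl1 : (1 : ℝ) ≤ l := by exact_mod_cast Int.add_one_le_iff.2 (by exact_mod_cast hlpos : 0 < l)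
  have e0 : Real.exp (-s.1 / 2) ≤ Real.exp (-s'.1 / 2) := by
    rw [← h0]; exact le_mul_of_one_le_left (Real.exp_pos _).le hk1
  have e1 : Real.exp (s.1 / 2) ≤ Real.exp (s'.1 / 2) := by
    rw [← h1]; exact le_mul_of_one_le_left (Real.exp_pos _).le hl1
  rw [Real.exp_le_exp] at e0 e1
  linarith

/-! ### Divergence of the orbit into the cusp -/

/-- Locally uniform bounds for the bottom row of the inverse of an adelic matrix. -/
lemma eventually_inv_bottomRow_le (g : GA) : ∃ C : ℝ, 0 < C ∧ ∃ N : ℕ, 0 < N ∧ ∀ᶠ h in 𝓝 g,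
    ∀ j, |(h⁻¹).1.1.val 1 j| ≤ C ∧
      ∀ p : Primes, ‖(N : ℚ_[p]) * ((h⁻¹).1.2 p).val 1 j‖ ≤ 1 := by
  let c : Primes → ℝ := fun p => Finset.univ.sup' Finset.univ_nonempty
    fun ij : Fin 2 × Fin 2 => ‖((g⁻¹).1.2 p).val ij.1 ij.2‖
  have hc : ∀ᶠ p in cofinite, c p ≤ 1 := by
    filter_upwards [(g⁻¹).1.2.2] with p hp
    exact Finset.sup'_le _ _ fun ij _ => norm_le_of_mem hp ij.1 ij.2
  have hcl : ∀ p i j, ‖((g⁻¹).1.2 p).val i j‖ ≤ c p := fun p i j =>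
    Finset.le_sup' (fun ij : Fin 2 × Fin 2 => ‖((g⁻¹).1.2 p).val ij.1 ij.2‖)
      (Finset.mem_univ (i, j))
  obtain ⟨N, hN, hNc⟩ := exists_nat_norm_mul_le_one hc
  refine ⟨1 + ∑ j, |(g⁻¹).1.1.val 1 j|, by positivity, N, hN, ?_⟩
  have hreal : ∀ j, ∀ᶠ h in 𝓝 g, |(h⁻¹).1.1.val 1 j| ≤ 1 + ∑ j, |(g⁻¹).1.1.val 1 j| := by
    intro j
    have hcont : Continuous fun h : GA => |(h⁻¹).1.1.val 1 j| :=
      ((continuous_realEntry 1 j).comp continuous_inv).abs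
    refine (hcont.tendsto g).eventually (ge_mem_nhds ?_)
    have := Finset.single_le_sum (f := fun j => |(g⁻¹).1.1.val 1 j|)
      (fun j _ => abs_nonneg _) (Finset.mem_univ j)
    linarith
  have hfin : ∀ᶠ h in 𝓝 g, ∀ p : Primes, (h⁻¹ * g).1.2 p ∈ intGL p := by
    have hcont : Continuous fun h : GA => h⁻¹ * g := by fun_prop
    refine (isOpen_integral.preimage hcont).mem_nhds ?_
    intro p
    change ((g⁻¹ * g : GA)).1.2 p ∈ _
    rw [inv_mul_cancel]
    exact one_mem _
  filter_upwards [eventually_all.2 hreal, hfin] with h h1 h2 j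
  refine ⟨h1 j, fun p => ?_⟩
  have hmul : ((h⁻¹).1.2 p).val = ((h⁻¹ * g).1.2 p).val * ((g⁻¹).1.2 p).val := by
    conv_lhs => rw [← mul_inv_cancel_right h⁻¹ g]
    rfl
  rw [hmul, Matrix.mul_apply, Finset.mul_sum]
  refine IsUltrametricDist.norm_sum_le_of_forall_le_of_nonneg zero_le_one fun l _ => ?_
  rw [norm_mul, norm_mul, mul_left_comm]
  refine mul_le_one₀ (norm_le_of_mem (h2 p) 1 l) (by positivity) ?_
  exact (mul_le_mul_of_nonneg_left (hcl p l j) (norm_nonneg _)).trans (hNc p)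

/-- The real bottom row `(0, e^{t/2})` of `a(t) u_n` does not depend on the shear. If `γ g` is the
sheared point and `g` stays in a compact set, then the bottom row of `γ` is a nonzero rational
vector of real size `O(e^{t/2})` and with bounded denominators, and so `t` is bounded from below. -/
lemma exists_neg_le_time_of_isCompact {K : Set XA} (hK : IsCompact K) :
    ∃ C : ℝ, ∀ (s : ℝ × CompactDiag) (n m : ℕ), XA.mk (aPlus s * shear n m) ∈ K → -C ≤ s.1 := by
  refine hK.induction_on (p := fun K : Set XA => ∃ C : ℝ, ∀ (s : ℝ × CompactDiag) (n m : ℕ),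
    XA.mk (aPlus s * shear n m) ∈ K → -C ≤ s.1) ⟨0, fun _ _ _ h => h.elim⟩
    (fun A B hAB ⟨C, hC⟩ => ⟨C, fun s n m h => hC s n m (hAB h)⟩) ?_ ?_
  · rintro A B ⟨C, hC⟩ ⟨D, hD⟩
    refine ⟨max C D, fun s n m h => ?_⟩
    rcases h with h | h
    · exact (neg_le_neg (le_max_left C D)).trans (hC s n m h)
    · exact (neg_le_neg (le_max_right C D)).trans (hD s n m h)
  intro x _
  obtain ⟨g, rfl⟩ := isOpenQuotientMap_mk.surjective x
  obtain ⟨C, hC, N, hN, hev⟩ := eventually_inv_bottomRow_le g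
  refine ⟨XA.mk '' {h | ∀ j, |(h⁻¹).1.1.val 1 j| ≤ C ∧
      ∀ p : Primes, ‖(N : ℚ_[p]) * ((h⁻¹).1.2 p).val 1 j‖ ≤ 1},
    mem_nhdsWithin_of_mem_nhds (isOpenQuotientMap_mk.isOpenMap.image_mem_nhds hev),
    2 * Real.log (N * C), ?_⟩
  rintro s n m ⟨h, hh, e⟩
  obtain ⟨q, hq⟩ := mk_eq_mk_iff_exists.1 e
  have hq' : ratDiag q = (aPlus s * shear n m).1 * (h⁻¹).1 := by
    rw [Subgroup.coe_inv, eq_mul_inv_iff_mul_eq, hq]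
  have hreal : ∀ j, ((q.val 1 j : ℚ) : ℝ) = Real.exp (s.1 / 2) * (h⁻¹).1.1.val 1 j := by
    intro j
    rw [← ratDiag_real_val, hq']
    change ((aPlus s * shear n m).1.1.val * (h⁻¹).1.1.val) 1 j = _
    rw [orbit_real_val, Matrix.mul_apply, Fin.sum_univ_two]
    simp
  have hfin : ∀ j (p : Primes), ((q.val 1 j : ℚ) : ℚ_[p]) =
      ((s.2 p).2 : ℚ_[p]) * ((h⁻¹).1.2 p).val 1 j := by
    intro j p
    rw [← ratFin_apply]
    change ((ratDiag q).2 p).val 1 j = _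
    rw [hq']
    change (((aPlus s * shear n m).1.2 p).val * ((h⁻¹).1.2 p).val) 1 j = _
    rw [orbit_finite_val, Matrix.mul_apply, Fin.sum_univ_two]
    simp
  obtain ⟨j, hj⟩ : ∃ j, q.val 1 j ≠ 0 := by
    by_contra! hzero
    refine (Matrix.isUnit_iff_isUnit_det _).1 q.isUnit |>.ne_zero ?_
    exact Matrix.det_eq_zero_of_row_eq_zero 1 hzero
  obtain ⟨k, hk⟩ := exists_int_of_norm_le_one (x := N * q.val 1 j) fun p => by
    have hunit : ‖((s.2 p).2 : ℚ_[p])‖ = 1 := PadicInt.isUnit_iff.1 (s.2 p).2.isUnit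
    rw [Rat.cast_mul, Rat.cast_natCast, hfin, mul_left_comm, norm_mul, hunit, one_mul]
    exact (hh j).2 p
  have hk0 : k ≠ 0 := by
    rintro rfl
    have : (N : ℚ) ≠ 0 := by exact_mod_cast hN.ne'
    simp [this, hj] at hk
  have hkabs : (1 : ℝ) ≤ |(k : ℝ)| := by exact_mod_cast Int.one_le_abs hk0
  have hN' : (0 : ℝ) < N := by exact_mod_cast hN
  have hk' : (k : ℝ) = N * (Real.exp (s.1 / 2) * (h⁻¹).1.1.val 1 j) := by
    rw [← hreal]
    exact_mod_cast hk.symm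
  have hle : 1 ≤ Real.exp (s.1 / 2) * (N * C) := by
    calc (1 : ℝ) ≤ |(k : ℝ)| := hkabs
      _ = Real.exp (s.1 / 2) * (N * |(h⁻¹).1.1.val 1 j|) := by
          rw [hk', abs_mul, abs_mul, abs_of_pos hN', abs_of_pos (Real.exp_pos _)]; ring
      _ ≤ _ := by gcongr; exact (hh j).1
  have := Real.log_nonneg hle
  rw [Real.log_mul (Real.exp_ne_zero _) (by positivity), Real.log_exp] at this
  linarith

/-! ### The reflection of the sheared orbit -/

/-- The involution `(-1 0; x 1)` of determinant `-1`. -/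
def lowerInvolution {R : Type*} [CommRing R] (x : R) : GL (Fin 2) R where
  val := !![-1, 0; x, 1]
  inv := !![-1, 0; x, 1]
  val_inv := by simp [Matrix.one_fin_two]
  inv_val := by simp [Matrix.one_fin_two]

/-- The permutation matrix `(0 1; 1 0)`. -/
def swapMatrix (R : Type*) [CommRing R] : GL (Fin 2) R where
  val := !![0, 1; 1, 0]
  inv := !![0, 1; 1, 0]
  val_inv := by simp [Matrix.one_fin_two]
  inv_val := by simp [Matrix.one_fin_two]

/-- A compact set of real matrices that contains the real components of all the elements by which
the sheared orbits are reflected. -/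
def realReflections : Set (GL (Fin 2) ℝ) :=
  insert (swapMatrix ℝ) (lowerInvolution '' Set.Icc 0 1)

/-- Parameters for a compact family of elements of `G_𝔸`: a real matrix of `realReflections`, and
the lower left entries of the components at the primes. -/
abbrev ReflectionParam : Type := realReflections × ((p : Primes) → ℤ_[p])

lemma abs_det_of_mem_realReflections {r : GL (Fin 2) ℝ} (hr : r ∈ realReflections) :
    |r.val.det| = 1 := by
  rcases hr with rfl | ⟨x, -, rfl⟩
  · simp [swapMatrix, Matrix.det_fin_two]
  · simp [lowerInvolution, Matrix.det_fin_two]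

lemma map_lowerInvolution_mem (p : Primes) (z : ℤ_[p]) :
    Matrix.GeneralLinearGroup.map (PadicInt.Coe.ringHom (p := p)) (lowerInvolution z) ∈ intGL p :=
  ⟨_, rfl⟩

/-- The element of `G_𝔸` with real component `y.1` and components `(-1 0; y.2 p 1)` at the
primes `p`. -/
noncomputable def reflection (y : ReflectionParam) : GA :=
  ⟨(y.1.1, RestrictedProduct.structureMap _ _ _ fun p => ⟨_, map_lowerInvolution_mem p (y.2 p)⟩), by
    have h : ∀ p : Primes, ‖(Matrix.GeneralLinearGroup.map (n := Fin 2)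
        (PadicInt.Coe.ringHom (p := p)) (lowerInvolution (y.2 p))).val.det‖ = 1 := fun p =>
      norm_det_of_mem_intGL (map_lowerInvolution_mem p (y.2 p))
    rw [GA, MonoidHom.mem_ker]
    change |y.1.1.val.det| * ∏ᶠ p : Primes, ‖(Matrix.GeneralLinearGroup.map (n := Fin 2)
        (PadicInt.Coe.ringHom (p := p)) (lowerInvolution (y.2 p))).val.det‖ = 1
    simp only [h, finprod_one, mul_one, abs_det_of_mem_realReflections y.1.2]⟩

lemma continuous_lowerInvolution {R : Type*} [CommRing R] [TopologicalSpace R]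
    [IsTopologicalRing R] : Continuous (lowerInvolution (R := R)) := by
  have h : Continuous fun x : R => (!![-1, 0; x, 1] : Matrix (Fin 2) (Fin 2) R) := by
    refine continuous_matrix fun i j => ?_
    fin_cases i <;> fin_cases j <;> simp <;> fun_prop
  exact Units.continuous_iff.2 ⟨h, h⟩

lemma isCompact_realReflections : IsCompact realReflections :=
  (isCompact_Icc.image continuous_lowerInvolution).insert _

instance : CompactSpace realReflections :=
  isCompact_iff_compactSpace.1 isCompact_realReflections

lemma continuous_reflection : Continuous reflection := by
  refine Continuous.subtype_mk (Continuous.prodMk (continuous_subtype_val.comp continuous_fst) ?_) _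
  refine Continuous.comp RestrictedProduct.isEmbedding_structureMap.continuous ?_
  refine continuous_pi fun p => Continuous.subtype_mk ?_ _
  refine (continuous_glMap _ ?_).comp (continuous_lowerInvolution.comp
    ((continuous_apply p).comp continuous_snd))
  exact continuous_subtype_val

/-- The parameter of the element by which the orbit translated by `shear n m` is reflected. -/
noncomputable def shearParam (n m : ℕ) : ReflectionParam :=
  (if hn : n = 0 then ⟨swapMatrix ℝ, Set.mem_insert _ _⟩
    else ⟨lowerInvolution ((n : ℝ)⁻¹), Set.mem_insert_of_mem _ ⟨_, ⟨by positivity,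
      inv_le_one_of_one_le₀ (by exact_mod_cast Nat.one_le_iff_ne_zero.2 hn)⟩, rfl⟩⟩,
    fun p => (m : ℤ_[p]))

/-- The reflection of `A_𝔸⁺` in the time `T`, which also exchanges the two diagonal entries at
every prime. -/
def timeReflection (T : ℝ) (s : ℝ × CompactDiag) : ℝ × CompactDiag :=
  (2 * T - s.1, fun p => (s.2 p).swap)

/-- The rational matrix `(0 1/m; m 0)`. -/
def antidiagonal (m : ℕ) (hm : m ≠ 0) : GL (Fin 2) ℚ where
  val := !![0, 1 / (m : ℚ); (m : ℚ), 0]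
  inv := !![0, 1 / (m : ℚ); (m : ℚ), 0]
  val_inv := by simp [Matrix.one_fin_two, hm]
  inv_val := by simp [Matrix.one_fin_two, hm]

lemma reflection_shearParam_real_zero (m : ℕ) :
    (reflection (shearParam 0 m)).1.1.val = !![0, 1; 1, 0] := by
  change (shearParam 0 m).1.1.val = _
  simp [shearParam, swapMatrix]

lemma reflection_shearParam_real_of_ne_zero {n : ℕ} (hn : n ≠ 0) (m : ℕ) :
    (reflection (shearParam n m)).1.1.val = !![-1, 0; (n : ℝ)⁻¹, 1] := by
  change (shearParam n m).1.1.val = _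
  simp [shearParam, hn, lowerInvolution]

lemma reflection_shearParam_finite (n m : ℕ) (p : Primes) :
    ((reflection (shearParam n m)).1.2 p).val = !![-1, 0; (m : ℚ_[p]), 1] := by
  change (Matrix.GeneralLinearGroup.map (PadicInt.Coe.ringHom (p := p))
    (lowerInvolution (m : ℤ_[p]))).val = _
  ext i j
  fin_cases i <;> fin_cases j <;> simp [lowerInvolution]

/-- The sheared orbit is carried to itself, with the time running backwards from `2 T`, by an
element of a compact set that does not depend on the shear. -/
lemma mk_aPlus_mul_shear_mul_reflection (s : ℝ × CompactDiag) (n : ℕ) {m : ℕ} (hm : m ≠ 0) :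
    XA.mk (aPlus s * shear n m * reflection (shearParam n m)) =
      XA.mk (aPlus (timeReflection (shearTime n m) s) * shear n m) := by
  refine mk_eq_mk_iff_exists.2 ⟨antidiagonal m hm, ?_⟩
  refine Prod.ext (Units.ext ?_) (RestrictedProduct.ext _ _ fun p => Units.ext ?_)
  · change (ratDiag (antidiagonal m hm)).1.val * ((aPlus s * shear n m).1.1.val *
      (reflection (shearParam n m)).1.1.val) = _
    have hγ : (ratDiag (antidiagonal m hm)).1.val = !![0, 1 / (m : ℝ); (m : ℝ), 0] := by
      ext i j
      rw [ratDiag_real_val]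
      fin_cases i <;> fin_cases j <;> simp [antidiagonal]
    have hm' : (m : ℝ) ≠ 0 := by exact_mod_cast hm
    have hpos : (0 : ℝ) < ((max 1 n * m : ℕ) : ℝ) := by
      exact_mod_cast Nat.mul_pos (by simp) (Nat.pos_of_ne_zero hm)
    have e1 : Real.exp (-(timeReflection (shearTime n m) s).1 / 2) =
        Real.exp (s.1 / 2) / ((max 1 n * m : ℕ) : ℝ) := by
      rw [show -(timeReflection (shearTime n m) s).1 / 2 = s.1 / 2 - shearTime n m by
        simp [timeReflection]; ring,
        Real.exp_sub, shearTime, Real.exp_log hpos]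
    have e2 : Real.exp ((timeReflection (shearTime n m) s).1 / 2) =
        Real.exp (-s.1 / 2) * ((max 1 n * m : ℕ) : ℝ) := by
      rw [show (timeReflection (shearTime n m) s).1 / 2 = -s.1 / 2 + shearTime n m by
        simp [timeReflection]; ring,
        Real.exp_add, shearTime, Real.exp_log hpos]
    rw [orbit_real_val, orbit_real_val, hγ, e1, e2]
    rcases eq_or_ne n 0 with rfl | hn
    · rw [reflection_shearParam_real_zero]
      ext i j
      fin_cases i <;> fin_cases j <;> simp <;> field_simp
    · rw [reflection_shearParam_real_of_ne_zero hn,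
        max_eq_right (Nat.one_le_iff_ne_zero.2 hn)]
      have hn' : (n : ℝ) ≠ 0 := by exact_mod_cast hn
      push_cast
      ext i j
      fin_cases i <;> fin_cases j <;> simp <;> field_simp
      simp
  · change ((ratFin (antidiagonal m hm)) p).val * (((aPlus s * shear n m).1.2 p).val *
      ((reflection (shearParam n m)).1.2 p).val) = _
    have hγ : ((ratFin (antidiagonal m hm)) p).val = !![0, 1 / (m : ℚ_[p]); (m : ℚ_[p]), 0] := by
      ext i j
      rw [ratFin_apply]
      fin_cases i <;> fin_cases j <;> simp [antidiagonal]
    have hm' : (m : ℚ_[p]) ≠ 0 := by exact_mod_cast hm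
    rw [orbit_finite_val, orbit_finite_val, hγ, reflection_shearParam_finite]
    ext i j
    fin_cases i <;> fin_cases j <;> simp [timeReflection] <;> field_simp
    simp

/-! ### Haar measure of the time slabs -/

/-- The part of `A_𝔸⁺` with real times in `I`. -/
abbrev slab (I : Set ℝ) : Set (ℝ × CompactDiag) := I ×ˢ Set.univ

instance : CompactSpace CompactDiag :=
  have (p : Primes) : CompactSpace ℤ_[p]ˣ := inferInstance
  inferInstance

instance : IsProbabilityMeasure (Measure.haarMeasure (⊤ : TopologicalSpace.PositiveCompacts
    CompactDiag)) :=
  ⟨Measure.haarMeasure_self⟩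

lemma haarPlus_slab (I : Set ℝ) : haarPlus (slab I) = volume I := by
  rw [haarPlus, Measure.prod_prod, measure_univ, mul_one]

lemma measurePreserving_timeReflection (T : ℝ) :
    MeasurePreserving (timeReflection T) haarPlus haarPlus := by
  let φ : CompactDiag →* CompactDiag :=
    { toFun := fun c p => (c p).swap
      map_one' := rfl
      map_mul' := fun _ _ => rfl }
  have hφ : Continuous φ := continuous_pi fun p => continuous_swap.comp (continuous_apply p)
  have hsurj : Function.Surjective φ := fun c => ⟨φ c, rfl⟩
  exact (Measure.measurePreserving_sub_left volume (2 * T)).prod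
    (φ.measurePreserving hφ hsurj rfl)

lemma timeReflection_preimage_slab_Ioi (T : ℝ) :
    timeReflection T ⁻¹' slab (Set.Ioi T) = slab (Set.Iio T) := by
  ext s
  simp only [Set.mem_preimage, Set.mem_prod, Set.mem_univ, and_true, Set.mem_Ioi, Set.mem_Iio,
    timeReflection]
  constructor <;> intro h <;> linarith

/-- Folding an integral over `A_𝔸⁺` at the time `T`. -/
lemma integral_haarPlus_eq_add_reflection {F : ℝ × CompactDiag → ℝ} (hF : Integrable F haarPlus)
    (T : ℝ) : ∫ s, F s ∂haarPlus = (∫ s in slab (Set.Iic T), F s ∂haarPlus) +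
      ∫ s in slab (Set.Iic T), F (timeReflection T s) ∂haarPlus := by
  have hmeas : MeasurableSet (slab (Set.Iic T)) := measurableSet_Iic.prod MeasurableSet.univ
  have hcompl : (slab (Set.Iic T))ᶜ = slab (Set.Ioi T) := by ext; simp
  have hmp := measurePreserving_timeReflection T
  have hae : slab (Set.Iic T) =ᵐ[haarPlus] slab (Set.Iio T) :=
    Measure.set_prod_ae_eq Iio_ae_eq_Iic.symm EventuallyEq.rfl
  rw [← integral_add_compl hmeas hF, hcompl,
    setIntegral_congr_set (f := fun s => F (timeReflection T s)) hae]
  congr 1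
  conv_lhs => rw [← hmp.map_eq]
  rw [setIntegral_map (measurableSet_Ioi.prod MeasurableSet.univ)
    (hmp.map_eq.symm ▸ hF.aestronglyMeasurable) hmp.measurable.aemeasurable,
    timeReflection_preimage_slab_Ioi]

/-- A bounded function that vanishes at times before `-C` gains at most a bounded amount from the
negative times. -/
lemma abs_setIntegral_Iic_sub_setIntegral_Icc_le {F : ℝ × CompactDiag → ℝ}
    (hF : Integrable F haarPlus) {B C T : ℝ} (hB : ∀ s, ‖F s‖ ≤ B) (hC : 0 ≤ C) (hT : 0 ≤ T)
    (hFC : ∀ s, F s ≠ 0 → -C ≤ s.1) :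
    |(∫ s in slab (Set.Iic T), F s ∂haarPlus) - ∫ s in slab (Set.Icc 0 T), F s ∂haarPlus|
      ≤ B * C := by
  have hunion : slab (Set.Iic T) = slab (Set.Iio 0) ∪ slab (Set.Icc 0 T) := by
    rw [← Set.union_prod, Set.Iio_union_Icc_eq_Iic hT]
  have hdisj : Disjoint (slab (Set.Iio 0)) (slab (Set.Icc 0 T)) := by
    rw [Set.disjoint_left]
    rintro s ⟨h1, -⟩ ⟨h2, -⟩
    exact absurd h2.1 (not_le.2 h1)
  have hvanish : ∫ s in slab (Set.Iio 0), F s ∂haarPlus =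
      ∫ s in slab (Set.Ico (-C) 0), F s ∂haarPlus := by
    refine setIntegral_eq_of_subset_of_forall_sdiff_eq_zero
      (measurableSet_Iio.prod MeasurableSet.univ) ?_ ?_
    · rintro s ⟨h, -⟩
      exact ⟨h.2, trivial⟩
    · rintro s ⟨⟨h1, -⟩, h2⟩
      by_contra h
      exact h2 ⟨⟨hFC s h, h1⟩, trivial⟩
  rw [hunion, setIntegral_union hdisj (measurableSet_Icc.prod MeasurableSet.univ)
    hF.integrableOn hF.integrableOn, add_sub_cancel_right, hvanish]
  have hvol : haarPlus (slab (Set.Ico (-C) 0)) = ENNReal.ofReal C := by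
    rw [haarPlus_slab, Real.volume_Ico, zero_sub, neg_neg]
  have := norm_setIntegral_le_of_norm_le_const (f := F) (C := B)
    (hvol ▸ ENNReal.ofReal_lt_top) fun s _ => hB s
  rwa [measureReal_def, hvol, ENNReal.toReal_ofReal hC] at this

/-! ### The sheared orbit measures -/

lemma continuous_mk_aPlus_mul (g : GA) : Continuous fun s => XA.mk (aPlus s * g) :=
  continuous_mk.comp (continuous_aPlus.mul continuous_const)

lemma translate_inv_orbitMeasure (g : GA) :
    translate g⁻¹ orbitMeasure = haarPlus.map fun s => XA.mk (aPlus s * g) := by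
  rw [translate, inv_inv, orbitMeasure, Measure.map_map (continuous_mulRight _).measurable
    continuous_orbitMap.measurable]
  simp only [Function.comp_def, origin_mulRight, mulRight_mk]

lemma preimage_orbitSegment (I : Set ℝ) :
    (fun s => XA.origin.mulRight (aPlus s)) ⁻¹' orbitSegment I = slab I := by
  ext s
  simp only [Set.mem_preimage, orbitSegment, Set.mem_ofPred_eq, origin_mulRight, Set.mem_prod,
    Set.mem_univ, and_true]
  constructor
  · rintro ⟨s', hs', e⟩
    rwa [time_eq_of_mk_aPlus_eq e]
  · exact fun h => ⟨s, h, rfl⟩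

lemma measurableSet_orbitSegment {I : Set ℝ} (hI : IsCompact I) :
    MeasurableSet (orbitSegment I) := by
  have : orbitSegment I = (fun s => XA.origin.mulRight (aPlus s)) '' slab I := by
    ext x
    simp only [orbitSegment, Set.mem_ofPred_eq, Set.mem_image, Set.mem_prod, Set.mem_univ, and_true]
    exact exists_congr fun s => and_congr_right fun _ => eq_comm
  rw [this]
  exact ((hI.prod isCompact_univ).image continuous_orbitMap).isClosed.measurableSet

lemma translate_inv_orbitMeasureOn (g : GA) {I : Set ℝ} (hI : IsCompact I) :
    translate g⁻¹ (orbitMeasureOn I) =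
      (haarPlus.restrict (slab I)).map fun s => XA.mk (aPlus s * g) := by
  rw [translate, inv_inv, orbitMeasureOn, orbitMeasure,
    Measure.restrict_map continuous_orbitMap.measurable (measurableSet_orbitSegment hI),
    preimage_orbitSegment, Measure.map_map (continuous_mulRight _).measurable
    continuous_orbitMap.measurable]
  simp only [Function.comp_def, origin_mulRight, mulRight_mk]

lemma integral_translate_inv_orbitMeasure (g : GA) {f : XA → ℝ} (hf : Continuous f) :
    ∫ x, f x ∂(translate g⁻¹ orbitMeasure) = ∫ s, f (XA.mk (aPlus s * g)) ∂haarPlus := by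
  rw [translate_inv_orbitMeasure, integral_map (continuous_mk_aPlus_mul g).aemeasurable
    hf.aestronglyMeasurable]

lemma integral_translate_inv_orbitMeasureOn (g : GA) {I : Set ℝ} (hI : IsCompact I) {f : XA → ℝ}
    (hf : Continuous f) : ∫ x, f x ∂(translate g⁻¹ (orbitMeasureOn I)) =
      ∫ s in slab I, f (XA.mk (aPlus s * g)) ∂haarPlus := by
  rw [translate_inv_orbitMeasureOn g hI, integral_map (continuous_mk_aPlus_mul g).aemeasurable
    hf.aestronglyMeasurable]

lemma translate_inv_orbitMeasureOn_univ (g : GA) {I : Set ℝ} (hI : IsCompact I) :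
    translate g⁻¹ (orbitMeasureOn I) Set.univ = volume I := by
  rw [translate_inv_orbitMeasureOn g hI,
    Measure.map_apply (continuous_mk_aPlus_mul g).measurable MeasurableSet.univ,
    Set.preimage_univ, Measure.restrict_apply_univ, haarPlus_slab]

/-- The reflection of the orbit turns the lower bound for the times at which the sheared orbits
visit a compact set into an upper bound. Both are uniform in the translates by reflections. -/
lemma exists_time_bounds_of_isCompact {K : Set XA} (hK : IsCompact K) :
    ∃ C : ℝ, 0 ≤ C ∧ ∀ (s : ℝ × CompactDiag) (n m : ℕ), m ≠ 0 →
      XA.mk (aPlus s * shear n m) ∈ K → s.1 ∈ Set.Icc (-C) (2 * shearTime n m + C) := by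
  obtain ⟨C, hC⟩ := exists_neg_le_time_of_isCompact hK
  have hK' : IsCompact ((fun y : XA × GA => y.1.mulRight y.2) '' (K ×ˢ Set.range reflection)) :=
    (hK.prod (isCompact_range continuous_reflection)).image continuous_mulRight_uncurry
  obtain ⟨D, hD⟩ := exists_neg_le_time_of_isCompact hK'
  refine ⟨max 0 (max C D), le_max_left _ _, fun s n m hm hs => ⟨?_, ?_⟩⟩
  · have := hC s n m hs
    have := (le_max_left C D).trans (le_max_right 0 _)
    linarith
  · have h := hD (timeReflection (shearTime n m) s) n m (by
      rw [← mk_aPlus_mul_shear_mul_reflection s n hm]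
      exact ⟨(_, _), ⟨hs, Set.mem_range_self (shearParam n m)⟩, rfl⟩)
    have := (le_max_right C D).trans (le_max_right 0 _)
    simp only [timeReflection] at h
    linarith

lemma isNonzeroLocallyFinite_translate (n : ℕ) {m : ℕ} (hm : m ≠ 0) :
    IsNonzeroLocallyFinite (translate (shear n m)⁻¹ orbitMeasure) := by
  rw [translate_inv_orbitMeasure]
  refine ⟨fun h => ?_, fun K hK => ?_⟩
  · rw [Measure.map_eq_zero_iff (continuous_mk_aPlus_mul _).aemeasurable] at h
    have h1 := haarPlus_slab Set.univ
    simp [h] at h1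
  · rw [Measure.map_apply (continuous_mk_aPlus_mul _).measurable hK.isClosed.measurableSet]
    obtain ⟨C, -, hC⟩ := exists_time_bounds_of_isCompact hK
    refine lt_of_le_of_lt (measure_mono (t := slab (Set.Icc (-C) (2 * shearTime n m + C)))
      fun s hs => ⟨hC s n m hm hs, trivial⟩) ?_
    rw [haarPlus_slab, Real.volume_Icc]
    exact ENNReal.ofReal_lt_top

/-! ### Equidistribution -/

/-- If `f` is continuous with compact support, then the translates of `f` by `R k` depend
continuously on `k`, in the uniform norm. -/
lemma eventually_forall_abs_mulRight_sub_lt {P : Type*} [TopologicalSpace P] [CompactSpace P]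
    {R : P → GA} (hR : Continuous R) {f : XA → ℝ} (hf : Continuous f) (hfc : HasCompactSupport f)
    (k₀ : P) {ε : ℝ} (hε : 0 < ε) :
    ∀ᶠ k in 𝓝 k₀, ∀ x : XA, |f (x.mulRight (R k)) - f (x.mulRight (R k₀))| < ε := by
  have hL : IsCompact ((fun y : XA × GA => y.1.mulRight y.2) ''
      (tsupport f ×ˢ Set.range fun k => (R k)⁻¹)) :=
    (hfc.isCompact.prod (isCompact_range hR.inv)).image continuous_mulRight_uncurry
  have hcont : Continuous fun y : P × XA => f (y.2.mulRight (R y.1)) :=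
    hf.comp (continuous_mulRight_uncurry.comp
      (continuous_snd.prodMk (hR.comp continuous_fst)))
  have hcont' : Continuous fun y : P × XA => f (y.2.mulRight (R k₀)) :=
    hf.comp ((continuous_mulRight _).comp continuous_snd)
  have h := hL.eventually_forall_of_forall_eventually (x₀ := k₀)
    (P := fun k (x : XA) => |f (x.mulRight (R k)) - f (x.mulRight (R k₀))| < ε) fun x _ =>
      ((hcont.sub hcont').abs.tendsto (k₀, x)).eventually (gt_mem_nhds (by simpa using hε))
  filter_upwards [h] with k hk x
  have hzero : ∀ k' : P, x ∉ (fun y : XA × GA => y.1.mulRight y.2) ''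
      (tsupport f ×ˢ Set.range fun k => (R k)⁻¹) → f (x.mulRight (R k')) = 0 := by
    intro k' hx
    by_contra hne
    refine hx ⟨(x.mulRight (R k'), (R k')⁻¹),
      ⟨subset_tsupport f hne, Set.mem_range_self k'⟩, ?_⟩
    change (x.mulRight (R k')).mulRight (R k')⁻¹ = x
    rw [mulRight_mulRight, mul_inv_cancel, mulRight_one]
  by_cases hx : x ∈ (fun y : XA × GA => y.1.mulRight y.2) ''
      (tsupport f ×ˢ Set.range fun k => (R k)⁻¹)
  · exact hk x hx
  · rw [hzero k hx, hzero k₀ hx, sub_self, abs_zero]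
    exact hε

lemma hasCompactSupport_mulRight {f : XA → ℝ} (hfc : HasCompactSupport f) (g : GA) :
    HasCompactSupport fun x : XA => f (x.mulRight g) :=
  hfc.comp_homeomorph (mulRightHomeomorph g)

/-- Equidistribution towards the invariant measure is stable under translations by elements of a
compact set, even if these vary along the sequence. -/
lemma tendsto_integral_mulRight {P : Type*} [TopologicalSpace P] [CompactSpace P]
    {R : P → GA} (hR : Continuous R) {ν : ℕ → Measure XA} (hν : ∀ i, ν i Set.univ ≤ 1)
    {μ : Measure XA} (hμ : IsHaarProbability μ) (h : WeakStarTendsto ν μ) (k : ℕ → P)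
    {f : XA → ℝ} (hf : Continuous f) (hfc : HasCompactSupport f) :
    Tendsto (fun i => ∫ x, f (x.mulRight (R (k i))) ∂(ν i)) atTop (𝓝 (∫ x, f x ∂μ)) := by
  have hfin : ∀ i, IsFiniteMeasure (ν i) := fun i => ⟨(hν i).trans_lt ENNReal.one_lt_top⟩
  rw [tendsto_iff_ultrafilter]
  intro U hU
  -- Along an ultrafilter the translating elements converge.
  obtain ⟨k₀, -, hk₀⟩ := isCompact_univ.ultrafilter_le_nhds (U.map k) (by simp)
  have hlim : Tendsto (fun i => ∫ x, f (x.mulRight (R k₀)) ∂(ν i)) U (𝓝 (∫ x, f x ∂μ)) := by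
    have hinv : ∫ x, f (x.mulRight (R k₀)) ∂μ = ∫ x, f x ∂μ := by
      conv_rhs => rw [← hμ.translate_eq (R k₀)⁻¹, translate, inv_inv]
      rw [integral_map (continuous_mulRight _).aemeasurable hf.aestronglyMeasurable]
    rw [← hinv]
    exact (h _ (hf.comp (continuous_mulRight _)) (hasCompactSupport_mulRight hfc _)).mono_left hU
  have hdiff : Tendsto (fun i => (∫ x, f (x.mulRight (R (k i))) ∂(ν i)) -
      ∫ x, f (x.mulRight (R k₀)) ∂(ν i)) U (𝓝 0) := by
    rw [Metric.tendsto_nhds]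
    intro ε hε
    have hev : ∀ᶠ i in (U : Filter ℕ), ∀ x : XA,
        |f (x.mulRight (R (k i))) - f (x.mulRight (R k₀))| < ε / 2 :=
      hk₀ (eventually_forall_abs_mulRight_sub_lt hR hf hfc k₀ (half_pos hε))
    filter_upwards [hev] with i hi
    have hint : ∀ g : GA, Integrable (fun x : XA => f (x.mulRight g)) (ν i) := fun g =>
      (hf.comp (continuous_mulRight g)).integrable_of_hasCompactSupport
        (hasCompactSupport_mulRight hfc g)
    rw [dist_zero_right, ← integral_sub (hint _) (hint _)]
    have hle := norm_integral_le_of_norm_le_const (μ := ν i)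
      (Eventually.of_forall fun x : XA => (Real.norm_eq_abs _).trans_le (hi x).le)
    have hmass : (ν i).real Set.univ ≤ 1 := by
      rw [measureReal_def]
      exact ENNReal.toReal_le_of_le_ofReal zero_le_one (by simpa using hν i)
    nlinarith
  simpa using hdiff.add hlim

lemma shearTime_nonneg (n m : ℕ) : 0 ≤ shearTime n m := Real.log_natCast_nonneg _

lemma tendsto_shearTime {n m : ℕ → ℕ} (hm : ∀ i, 1 ≤ m i)
    (hdiv : Tendsto m atTop atTop ∨ Tendsto n atTop atTop) :
    Tendsto (fun i => shearTime (n i) (m i)) atTop atTop := by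
  refine Real.tendsto_log_atTop.comp (tendsto_natCast_atTop_atTop.comp ?_)
  rcases hdiv with h | h
  · exact tendsto_atTop_mono (fun i => Nat.le_mul_of_pos_left _ (by simp)) h
  · exact tendsto_atTop_mono
      (fun i => (le_max_right 1 (n i)).trans (Nat.le_mul_of_pos_right _ (hm i))) h

/-- The integral over the whole sheared orbit is, up to a bounded error, the sum of the integrals of
`f` and of a translate of `f` over the times in `[0, T]`: the times in `[T, 2T]` are the reflection
of those in `[0, T]`, and the other times contribute a bounded amount. -/
lemma exists_abs_integral_sub_le {f : XA → ℝ} (hf : Continuous f) (hfc : HasCompactSupport f) :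
    ∃ D : ℝ, ∀ (n m : ℕ), m ≠ 0 →
      |(∫ x, f x ∂(translate (shear n m)⁻¹ orbitMeasure)) -
        ((∫ x, f x ∂(translate (shear n m)⁻¹ (orbitMeasureOn (Set.Icc 0 (shearTime n m))))) +
          ∫ x, f (x.mulRight (reflection (shearParam n m)))
            ∂(translate (shear n m)⁻¹ (orbitMeasureOn (Set.Icc 0 (shearTime n m)))))| ≤ D := by
  obtain ⟨B, hB⟩ := hf.bounded_above_of_compact_support hfc
  obtain ⟨C, hC0, hC⟩ := exists_time_bounds_of_isCompact hfc.isCompact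
  refine ⟨B * C + B * C, fun n m hm => ?_⟩
  set T := shearTime n m with hTdef
  have hT : 0 ≤ T := shearTime_nonneg n m
  have hsupp : ∀ s, f (XA.mk (aPlus s * shear n m)) ≠ 0 → s.1 ∈ Set.Icc (-C) (2 * T + C) :=
    fun s hs => hC s n m hm (subset_tsupport f hs)
  have hcont : Continuous fun s => f (XA.mk (aPlus s * shear n m)) :=
    hf.comp (continuous_mk_aPlus_mul _)
  have hint : Integrable (fun s => f (XA.mk (aPlus s * shear n m))) haarPlus := by
    refine (integrableOn_iff_integrable_of_support_subset
      (s := slab (Set.Icc (-C) (2 * T + C))) fun s hs => ⟨hsupp s hs, trivial⟩).1 ?_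
    refine Measure.integrableOn_of_bounded ?_ hcont.aestronglyMeasurable (M := B)
      (Eventually.of_forall fun s => hB _)
    rw [haarPlus_slab, Real.volume_Icc]
    exact ENNReal.ofReal_ne_top
  have hmp := measurePreserving_timeReflection T
  rw [integral_translate_inv_orbitMeasure _ hf,
    integral_translate_inv_orbitMeasureOn _ isCompact_Icc hf,
    integral_translate_inv_orbitMeasureOn _ isCompact_Icc
      (f := fun x => f (x.mulRight (reflection (shearParam n m))))
      (hf.comp (continuous_mulRight _)),
    integral_haarPlus_eq_add_reflection hint T, add_sub_add_comm]
  simp only [mulRight_mk, mk_aPlus_mul_shear_mul_reflection _ n hm]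
  refine (abs_add_le _ _).trans (add_le_add ?_ ?_)
  · exact abs_setIntegral_Iic_sub_setIntegral_Icc_le hint (fun s => hB _) hC0 hT
      fun s hs => (hsupp s hs).1
  · refine abs_setIntegral_Iic_sub_setIntegral_Icc_le
      (F := fun s => f (XA.mk (aPlus (timeReflection T s) * shear n m)))
      (hmp.integrable_comp_of_integrable hint) (fun s => hB _) hC0 hT fun s hs => ?_
    have := (hsupp _ hs).2
    simp only [timeReflection] at this
    linarith

end AdelicShearing

theorem mainTheorem6 (μHaar : Measure XA) (hHaar : IsHaarProbability μHaar)
    (n m : ℕ → ℕ) (hm : ∀ i, 1 ≤ m i)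
    (hdiv : Tendsto m atTop atTop ∨ Tendsto n atTop atTop)
    (hn : ¬ Tendsto n atTop atTop → ∀ i, n i = 0)
    (hrestr : WeakStarTendsto
      (fun i => ENNReal.ofReal (1 / shearTime (n i) (m i)) •
        translate (shear (n i) (m i))⁻¹
          (orbitMeasureOn (Set.Icc 0 (shearTime (n i) (m i)))))
      μHaar) :
    ClassTendsto (fun i => translate (shear (n i) (m i))⁻¹ orbitMeasure) μHaar := by
  have hm0 : ∀ i, m i ≠ 0 := fun i => Nat.one_le_iff_ne_zero.1 (hm i)
  have hprob := hHaar.isProbabilityMeasure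
  have hTtop := tendsto_shearTime (n := n) hm hdiv
  refine ⟨fun i => isNonzeroLocallyFinite_translate (n i) (hm0 i),
    ⟨IsProbabilityMeasure.ne_zero μHaar, fun K _ => measure_lt_top μHaar K⟩,
    -- The maximum only serves to keep the scalars positive where `T = 0`.
    fun i => 1 / (2 * max 1 (shearTime (n i) (m i))), fun i => by positivity, ?_⟩
  intro f hf hfc
  set T : ℕ → ℝ := fun i => shearTime (n i) (m i) with hTdef
  have hT0 : ∀ i, 0 ≤ T i := fun i => shearTime_nonneg _ _
  have hmass : ∀ i, (ENNReal.ofReal (1 / T i) • translate (shear (n i) (m i))⁻¹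
      (orbitMeasureOn (Set.Icc 0 (T i)))) Set.univ ≤ 1 := by
    intro i
    rw [Measure.smul_apply, translate_inv_orbitMeasureOn_univ _ isCompact_Icc, Real.volume_Icc,
      smul_eq_mul, ← ENNReal.ofReal_mul (by have := hT0 i; positivity), sub_zero]
    refine ENNReal.ofReal_le_one.2 ?_
    rw [one_div_mul_eq_div]
    exact div_self_le_one _
  have h1 := hrestr f hf hfc
  have h2 := tendsto_integral_mulRight continuous_reflection hmass hHaar hrestr
    (fun i => shearParam (n i) (m i)) hf hfc
  obtain ⟨D, hD⟩ := exists_abs_integral_sub_le hf hfc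
  have h3 : Tendsto (fun i => ((∫ x, f x ∂(translate (shear (n i) (m i))⁻¹ orbitMeasure)) -
      ((∫ x, f x ∂(translate (shear (n i) (m i))⁻¹ (orbitMeasureOn (Set.Icc 0 (T i))))) +
        ∫ x, f (x.mulRight (reflection (shearParam (n i) (m i))))
          ∂(translate (shear (n i) (m i))⁻¹ (orbitMeasureOn (Set.Icc 0 (T i)))))) / T i)
      atTop (𝓝 0) := by
    refine squeeze_zero_norm (fun i => ?_) (hTtop.const_div_atTop D)
    rw [norm_div, Real.norm_of_nonneg (hT0 i)]
    exact div_le_div_of_nonneg_right (hD (n i) (m i) (hm0 i)) (hT0 i)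
  have hsum := ((h1.add h2).add h3).const_mul (1 / 2)
  rw [show 1 / 2 * ((∫ x, f x ∂μHaar) + (∫ x, f x ∂μHaar) + 0) = ∫ x, f x ∂μHaar by ring] at hsum
  refine hsum.congr' ?_
  filter_upwards [hTtop.eventually_ge_atTop 1] with i hi
  have hpos : 0 < T i := zero_lt_one.trans_le hi
  simp only [hTdef] at hi hpos ⊢
  simp only [integral_smul_measure, smul_eq_mul]
  rw [max_eq_right hi, ENNReal.toReal_ofReal (by positivity), ENNReal.toReal_ofReal (by positivity)]
  field_simp
  ring
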